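/- **Algorithms.** Let $f:\mathbb{R}^d\to\mathbb{R}$ be twice continuously differentiable. For a differentiable $g$, a positive semidefinite $H$ and $M>0$, the cubic regularized Newton (CRN) step $\mathcal{A}^{g}_{M}(\bar z,H)$ is the solution $z$ of $\nabla g(\bar z)+H(z-\bar z)+\frac{M}{2}\|z-\bar z\|(z-\bar z)=0$. *MS-Solver* at $\bar z$, with parameters $L,K,M,m,\gamma$: put $g(z)=f(z)+\frac{\gamma}{3}\|z-\bar z\|^3$ and $z^{(0)}=\mathcal{A}^{g}_{L}(\bar z,\nabla^2 g(\bar z))$; for $s=0,\dots,\lceil K/m\rceil-1$ put $z_{s,0}=z^{(s)}$, $z_{s,t+1}=\mathcal{A}^{g}_{M}(z_{s,t},\nabla^2 g(z_{s,0}))$ for $0\le t<m$, and $z^{(s+1)}=\frac1m\sum_{t=1}^m z_{s,t}$; return $\mathcal{A}^{g}_{L}(z^{(N)},\nabla^2 g(z^{(N)}))$ with $N=\lceil K/m\rceil$. *A-LEN* from $z_0$, with $T$ iterations and parameter $\alpha$: put $v_0=z_0$, $A_0=0$, let $\tilde z_1$ be the output of MS-Solver at $z_0$ and $\lambda_1'=\lambda_1=\gamma\|\tilde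 z_1-z_0\|$; if $\tilde z_1=z_0$, stop and return $z_0$. For $t=0,\dots,T-1$: $a'_{t+1}=\frac{1}{2\lambda'_{t+1}}\bigl(1+\sqrt{1+4\lambda'_{t+1}A_t}\bigr)$, $A'_{t+1}=A_t+a'_{t+1}$, $\bar z_t=\frac{A_t}{A'_{t+1}}z_t+\frac{a'_{t+1}}{A'_{t+1}}v_t$; if $t>0$, let $\tilde z_{t+1}$ be the output of MS-Solver at $\bar z_t$ and $\lambda_{t+1}=\gamma\|\tilde z_{t+1}-\bar z_t\|$. If $\lambda_{t+1}\le\lambda'_{t+1}$, put $a_{t+1}=a'_{t+1}$, $A_{t+1}=A'_{t+1}$, $z_{t+1}=\tilde z_{t+1}$, $\lambda'_{t+2}=\lambda'_{t+1}/\alpha$; otherwise, with $\rho=\lambda'_{t+1}/\lambda_{t+1}$, put $a_{t+1}=\rho a'_{t+1}$, $A_{t+1}=A_t+a_{t+1}$, $z_{t+1}=\frac{(1-\rho)A_t}{A_{t+1}}z_t+\frac{\rho A'_{t+1}}{A_{t+1}}\tilde z_{t+1}$, $\lambda'_{t+2}=\alpha\lambda'_{t+1}$. In both cases $v_{t+1}=v_t-a_{t+1}\nabla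 f(\tilde z_{t+1})$. Return $z_T$. *A-LEN-restart* from $z_0$: $z^{(0)}=z_0$, and $z^{(s+1)}$ is the output of A-LEN started at $z^{(s)}$. **Theorem.** There are absolute constants $c_K,c_T>0$, and for all $C_K,C_T$ there is a constant $C>0$ depending only on $C_K,C_T$, such that the following holds for all $d\ge 0$, $m\ge1$, $\mu,L>0$, every $\mu$-strongly convex $C^2$ function $f:\mathbb{R}^d\to\mathbb{R}$ with $L$-Lipschitz Hessian, with minimizer $z^*$, and every $z_0\in\mathbb{R}^d$. Put $D=\|z_0-z^*\|$, $\kappa=L/\mu$, and run A-LEN-restart from $z_0$ with $\alpha=2$, $\gamma=L/m$, $M=6m(L+2\gamma)$ (so $M=\mathcal{O}(mL)$) and integers $K\ge c_K\,m(1+\log m)$ and $T\ge 1$ with $T\ge c_T(\gamma D/\mu)^{2/7}$. For $\varepsilon\in(0,\frac12)$ let $S_\varepsilon=\lceil\log_{3/2}\log_2(1/\varepsilon)\rceil$. 1. For all $s\ge1$: $\|z^{(s)}-z^*\|^2\le\left(\tfrac12\right)^{(3/2)^s}\|z_0-z^*\|^2$. 2. For all $\varepsilon\in(0,\frac12)$: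 $\|z^{(S_\varepsilon)}-z^*\|\le\varepsilon\,\|z_0-z^*\|$. If moreover $T\ge c_T(\gamma D^3/\mu)^{2/7}$, then $\|z^{(S_\varepsilon)}-z^*\|\le\varepsilon$ for all $\varepsilon\in(0,\frac12)$. 3. If $K\le C_K\,m(1+\log m)$ and $T\le C_T(\gamma/\mu)^{2/7}$, then for all $\varepsilon\in(0,\frac14]$ both $S_\varepsilon(m+TK)$ and the number of CRN steps performed in the first $S_\varepsilon$ epochs are at most $$C\left(m+m^{5/7}(1+\log m)\,\kappa^{2/7}\right)\log\log(1/\varepsilon).$$ 4. If only $K\le C_K\,m(1+\log m)$ and $T\le C_T\bigl(1+(\gamma/\mu)^{2/7}\bigr)$, then for all $\varepsilon\in(0,\frac14]$ both numbers are at most $$C\left(m+m^{5/7}\kappa^{2/7}\right)(1+\log m)\log\log(1/\varepsilon).$$ -/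

import Mathlib

namespace LazyNewton

variable {E : Type*} [NormedAddCommGroup E] [InnerProductSpace ℝ E] [CompleteSpace E]

/-- The Hessian of `g` at `z`, as a continuous linear operator: the derivative of the gradient. -/
noncomputable def hess (g : E → ℝ) (z : E) : E →L[ℝ] E :=
  fderiv ℝ (gradient g) z

/-- `f` is twice continuously differentiable with `L`-Lipschitz Hessian (operator norm). -/
def HasLipschitzHessian (L : ℝ) (f : E → ℝ) : Prop :=
  ContDiff ℝ 2 f ∧ ∀ z z' : E, ‖hess f z - hess f z'‖ ≤ L * ‖z - z'‖

/-- The cubic regularized Newton (CRN) oracle of an operator `F` at `zbar` with matrix `H`: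
the set of solutions of `F zbar + H (z - zbar) + (M / 2) ‖z - zbar‖ (z - zbar) = 0`. -/
def crnOracle (M : ℝ) (F : E → E) (zbar : E) (H : E →L[ℝ] E) : Set E :=
  {z | F zbar + H (z - zbar) + (M / 2 * ‖z - zbar‖) • (z - zbar) = 0}

open Classical in
/-- One CRN step: a point of the oracle set. (For positive semidefinite `H` and `M > 0`, the only
case that occurs for convex functions, the oracle set has exactly one element; the value `zbar`
for an empty oracle set is a mere default.) -/
noncomputable def crnStep (M : ℝ) (F : E → E) (zbar : E) (H : E →L[ℝ] E) : E :=
  if h : (crnOracle M F zbar H).Nonempty then h.some else zbar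

/-- The second-order proximal function `z ↦ f z + (γ / 3) ‖z - zbar‖ ^ 3`. -/
noncomputable def proxFun (f : E → ℝ) (γ : ℝ) (zbar : E) : E → ℝ :=
  fun z => f z + γ / 3 * ‖z - zbar‖ ^ 3

/-- The lazy iterates `z_{s,0} = zs, …, z_{s,t}, …` within one epoch of the MS-solver: CRN steps
for `g`, all of them with the Hessian of `g` at the snapshot `zs`. -/
noncomputable def lazyIterate (g : E → ℝ) (M : ℝ) (zs : E) : ℕ → E
  | 0 => zs
  | t + 1 => crnStep M (gradient g) (lazyIterate g M zs t) (hess g zs)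

/-- One epoch of the MS-solver: `m` lazy CRN steps, followed by averaging. -/
noncomputable def lazyEpoch (g : E → ℝ) (M : ℝ) (m : ℕ) (zs : E) : E :=
  (1 / (m : ℝ)) • ∑ t ∈ Finset.Icc 1 m, lazyIterate g M zs t

/-- The MS-solver: a CRN step with parameter `L`, then `⌈K / m⌉` lazy epochs with parameter `M`,
then a CRN step with parameter `L`, all applied to `g = proxFun f γ zbar`. -/
noncomputable def msSolver (f : E → ℝ) (L : ℝ) (K : ℕ) (M : ℝ) (m : ℕ) (γ : ℝ) (zbar : E) : E :=
  let g := proxFun f γ zbar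
  let zfirst := crnStep L (gradient g) zbar (hess g zbar)
  let zlast := (lazyEpoch g M m)^[⌈(K : ℝ) / (m : ℝ)⌉₊] zfirst
  crnStep L (gradient g) zlast (hess g zlast)

/-- The number of CRN steps performed in one call of `msSolver`. -/
noncomputable def msSolverSteps (K m : ℕ) : ℕ :=
  1 + ⌈(K : ℝ) / (m : ℝ)⌉₊ * m + 1

/-- The state of A-LEN after `t` iterations: `z = z_t`, `v = v_t`, `A = A_t`,
`lam = λ'_{t+1}`, and the number of CRN steps performed so far. -/
structure ALenState (E : Type*) where
  z : E
  v : E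
  A : ℝ
  lam : ℝ
  steps : ℕ

/-- The state after `t` iterations of the loop of A-LEN started at `z₀`. The point `z1` is the
output of the MS-solver at `z₀`, which is computed before the loop and used for `t = 0`. -/
noncomputable def alenIter (f : E → ℝ) (L α : ℝ) (K : ℕ) (M : ℝ) (m : ℕ) (γ : ℝ) (z₀ z1 : E) :
    ℕ → ALenState E
  | 0 => ⟨z₀, z₀, 0, γ * ‖z1 - z₀‖, msSolverSteps K m⟩
  | t + 1 =>
    let st := alenIter f L α K M m γ z₀ z1 t
    let a' := 1 / (2 * st.lam) * (1 + √(1 + 4 * st.lam * st.A))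
    let A' := st.A + a'
    let zbar := (st.A / A') • st.z + (a' / A') • st.v
    let ztilde := if t = 0 then z1 else msSolver f L K M m γ zbar
    let lamNew := if t = 0 then st.lam else γ * ‖ztilde - zbar‖
    let stepsNew := if t = 0 then st.steps else st.steps + msSolverSteps K m
    if lamNew ≤ st.lam then
      { z := ztilde
        v := st.v - a' • gradient f ztilde
        A := A'
        lam := 1 / α * st.lam
        steps := stepsNew }
    else
      let ρ := st.lam / lamNew
      let a := ρ * a'
      let A := st.A + a
      { z := ((1 - ρ) * st.A / A) • st.z + (ρ * A' / A) • ztilde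
        v := st.v - a • gradient f ztilde
        A := A
        lam := α * st.lam
        steps := stepsNew }

open Classical in
/-- A-LEN with `T` iterations from `z₀`: the output and the number of CRN steps. If the first call
of the MS-solver returns `z₀` itself, then `λ'_1 = 0` and the weights `1 / (2 λ'_1)` of the method
are undefined; in that case the method stops and returns `z₀`. -/
noncomputable def alen (f : E → ℝ) (L : ℝ) (z₀ : E) (T : ℕ) (α : ℝ) (K : ℕ) (M : ℝ) (m : ℕ)
    (γ : ℝ) : E × ℕ :=
  let z1 := msSolver f L K M m γ z₀
  if z1 = z₀ then (z₀, msSolverSteps K m)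
  else
    let st := alenIter f L α K M m γ z₀ z1 T
    (st.z, st.steps)

/-- A-LEN-restart: the point `z^{(s)}` after `s` epochs, and the total number of CRN steps
performed in these epochs. -/
noncomputable def alenRestart (f : E → ℝ) (L : ℝ) (z₀ : E) (T : ℕ) (α : ℝ) (K : ℕ) (M : ℝ)
    (m : ℕ) (γ : ℝ) : ℕ → E × ℕ
  | 0 => (z₀, 0)
  | s + 1 =>
    let p := alenRestart f L z₀ T α K M m γ s
    let q := alen f L p.1 T α K M m γ
    (q.1, p.2 + q.2)

/-- The number of epochs `⌈log_{3/2} log_2 (1 / ε)⌉`. -/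
noncomputable def numEpochs (ε : ℝ) : ℕ :=
  ⌈Real.logb (3 / 2) (Real.logb 2 (1 / ε))⌉₊

end LazyNewton

/-! Adding `γ / 3 * ‖z - zbar‖ ^ 3` to a convex `f` gives a function `g` that is uniformly convex of
degree three and still has a Lipschitz Hessian (`cubicallyConvex_proxFun`). In a lazy CRN step the
stale Hessian costs an error proportional to the distance from the snapshot. With regularization `M`
of order `m L`, the cubic decrease accumulated over at most `m` steps outweighs all these errors.
Uniform convexity with `γ = L / m` in turn bounds the sum of the optimality gaps by `O(m)` times
that decrease. Hence the average of an epoch contracts the gap by an absolute factor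
(`sub_min_lazyEpoch_le`), and `O(1 + log m)` epochs gain any fixed power of `m`. A final CRN step
turns closeness to the minimizer into a small gradient, the Monteiro–Svaiter condition `‖∇g(y)‖ ≤ (γ
/ 2) ‖y - zbar‖ ^ 2` (`norm_gradient_proxFun_msSolver_le`).

Under this condition A-LEN never increases the potential `A (f z - f zstar) + ‖v - zstar‖ ^ 2 / 2`.
After the first iteration, halving the guess `λ'` comes with an increase of `√A` by at least `1 / (2
√λ')`, and doubling it comes with a potential drop of order `A λ' ^ 3 / γ ^ 2`. Since the total drop
is bounded by the initial potential, an amortized count (`iterations_le_of_growth`) forces `A_T` to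
be at least of order `T ^ (7/2) / (γ D)`. The final gap is then `O(γ D ^ 3 T ^ (-7/2))`
(`alen_sub_min_le`).

Strong convexity bounds the squared distance by the gap, so one call maps a distance `r` to some
`r'` with `r' ^ 2 ≤ const * (γ / μ) T ^ (-7/2) r ^ 3`. The lower bound on `T` makes the coefficient
at most `1 / (8 D)`, and restarting converges with order `3/2` (`norm_alenRestart_sub_le`). The work
per epoch is of order `T K`; the factor `m ^ (5/7)` is `m * m ^ (-2/7)`, from `K ≈ m (1 + log m)`
and `T ≈ (L / (m μ)) ^ (2/7)`. -/

namespace LazyNewton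
open scoped InnerProductSpace

/-! ### First-order facts on convex functions. -/

section Convexity

variable {E : Type*} [NormedAddCommGroup E] [InnerProductSpace ℝ E] [CompleteSpace E]

/-- First-order characterization of convexity. -/
theorem convexOn_add_inner_gradient_le {f : E → ℝ} (hf : ConvexOn ℝ Set.univ f)
    (hd : Differentiable ℝ f) (x y : E) : f x + ⟪gradient f x, y - x⟫_ℝ ≤ f y := by
  have hline : HasDerivAt (fun t : ℝ => f (x + t • (y - x))) ⟪gradient f x, y - x⟫_ℝ 0 := by
    have h1 : HasDerivAt (fun t : ℝ => x + t • (y - x)) (y - x) 0 := by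
      simpa using ((hasDerivAt_id (0 : ℝ)).smul_const (y - x)).const_add x
    have h2 : HasFDerivAt f (fderiv ℝ f x) (x + (0 : ℝ) • (y - x)) := by
      simpa using (hd x).hasFDerivAt
    have h3 := h2.comp_hasDerivAt (0 : ℝ) h1
    rw [inner_gradient_left]
    exact h3
  have hc : ConvexOn ℝ Set.univ (fun t : ℝ => f (x + t • (y - x))) := by
    refine ⟨convex_univ, fun s _ t _ a b ha hb hab => ?_⟩
    have := hf.2 (Set.mem_univ (x + s • (y - x))) (Set.mem_univ (x + t • (y - x))) ha hb hab
    refine le_trans (le_of_eq ?_) this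
    have hb' : b = 1 - a := by linarith
    subst hb'
    simp only [smul_eq_mul]
    congr 1
    module
  have := hc.le_slope_of_hasDerivAt (Set.mem_univ 0) (Set.mem_univ 1) one_pos hline
  rw [slope_def_field] at this
  simp only [one_smul, add_sub_cancel, zero_smul, add_zero, sub_zero, div_one] at this
  linarith

theorem gradient_eq_zero_of_forall_le {f : E → ℝ} {w : E} (h : ∀ z, f w ≤ f z) :
    gradient f w = 0 := by
  have h1 : IsLocalMin f w := Filter.Eventually.of_forall h
  simp [gradient, h1.fderiv_eq_zero]

end Convexity

/-! ### Growth at minimizers, the cubed norm, and solvability of the CRN equation. -/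

section NormPower

variable {E : Type*} [NormedAddCommGroup E] [InnerProductSpace ℝ E]

/-- A strongly convex function grows quadratically around its minimizer. -/
theorem half_mul_norm_sq_le_sub_of_strongConvexOn {f : E → ℝ} {μ : ℝ}
    (hf : StrongConvexOn Set.univ μ f) {w : E} (hw : ∀ z, f w ≤ f z) (y : E) :
    μ / 2 * ‖y - w‖ ^ 2 ≤ f y - f w := by
  -- Strong convexity on the segment from `y` to `w`, divided by the weight `1 - t` of `y`; the full
  -- constant `μ / 2` appears only in the limit `t → 1`.
  have key : ∀ t : ℝ, 0 < t → t < 1 → t * (μ / 2 * ‖y - w‖ ^ 2) ≤ f y - f w := by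
    intro t ht ht1
    have h := hf.2 (Set.mem_univ y) (Set.mem_univ w) (sub_nonneg.2 ht1.le) ht.le
      (sub_add_cancel 1 t)
    have h' := hw ((1 - t) • y + t • w)
    simp only [smul_eq_mul] at h
    have h2 : (1 - t) * (t * (μ / 2 * ‖y - w‖ ^ 2)) ≤ (1 - t) * (f y - f w) := by nlinarith
    exact le_of_mul_le_mul_left h2 (by linarith)
  have hlim : Filter.Tendsto (fun t : ℝ => t * (μ / 2 * ‖y - w‖ ^ 2)) (nhdsWithin 1 (Set.Iio 1))
      (nhds (1 * (μ / 2 * ‖y - w‖ ^ 2))) :=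
    ((continuous_id.mul continuous_const).tendsto 1).mono_left nhdsWithin_le_nhds
  rw [one_mul] at hlim
  refine le_of_tendsto hlim ?_
  filter_upwards [Ioo_mem_nhdsLT (show (0 : ℝ) < 1 by norm_num)] with t ht
  exact key t ht.1 ht.2

/-- A continuous function dominating a cubic in the distance attains its minimum. -/
theorem exists_forall_le_of_cubic_le [FiniteDimensional ℝ E] {f : E → ℝ} (hf : Continuous f)
    (x : E) {a b c : ℝ} (hc : 0 < c)
    (h : ∀ y, a - b * ‖y - x‖ + c * ‖y - x‖ ^ 3 ≤ f y) : ∃ w, ∀ y, f w ≤ f y := by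
  refine hf.exists_forall_le (Filter.tendsto_atTop_mono h ?_)
  have h1 : Filter.Tendsto (fun y : E => ‖y - x‖) (Filter.cocompact E) Filter.atTop := by
    have := tendsto_norm_cocompact_atTop (E := E)
    refine Filter.tendsto_atTop_mono (fun y => ?_)
      (Filter.tendsto_atTop_add_const_right _ (-‖x‖) this)
    have := norm_sub_norm_le y x
    linarith
  have h2 : Filter.Tendsto (fun r : ℝ => a - b * r + c * r ^ 3) Filter.atTop Filter.atTop := by
    have h3 : Filter.Tendsto (fun r : ℝ => a + r * (c * r ^ 2 - b)) Filter.atTop Filter.atTop := by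
      refine Filter.tendsto_atTop_add_const_left _ _ ?_
      refine Filter.Tendsto.atTop_mul_atTop₀ Filter.tendsto_id ?_
      exact Filter.tendsto_atTop_add_const_right _ _
        ((Filter.tendsto_pow_atTop two_ne_zero).const_mul_atTop hc)
    refine h3.congr fun r => ?_
    ring
  exact h2.comp h1

/-- The third power of the norm is uniformly convex of degree three. -/
theorem cube_norm_uniform_convex (x y : E) :
    ‖x‖ ^ 3 / 3 + ‖x‖ * ⟪x, y - x⟫_ℝ + ‖y - x‖ ^ 3 / 12 ≤ ‖y‖ ^ 3 / 3 := by
  have hs : ‖y - x‖ ^ 2 = ‖y‖ ^ 2 - 2 * ⟪y, x⟫_ℝ + ‖x‖ ^ 2 := norm_sub_sq_real y x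
  have hi : ⟪x, y - x⟫_ℝ = ⟪y, x⟫_ℝ - ‖x‖ ^ 2 := by
    rw [inner_sub_right, real_inner_self_eq_norm_sq, real_inner_comm]
  have htri : ‖y - x‖ ≤ ‖y‖ + ‖x‖ := norm_sub_le y x
  rw [hi]
  have ha := norm_nonneg x
  have hb := norm_nonneg y
  have hn := norm_nonneg (y - x)
  generalize ‖x‖ = a at *
  generalize ‖y‖ = b at *
  generalize ‖y - x‖ = n at *
  generalize ⟪y, x⟫_ℝ = s at *
  have hs' : s = (a ^ 2 + b ^ 2 - n ^ 2) / 2 := by linarith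
  subst hs'
  have hid : b ^ 3 / 3 - (a ^ 3 / 3 + a * ((a ^ 2 + b ^ 2 - n ^ 2) / 2 - a ^ 2)) =
      (b - a) ^ 2 * (2 * b + a) / 6 + a * n ^ 2 / 2 := by ring
  suffices h : n ^ 3 / 12 ≤ (b - a) ^ 2 * (2 * b + a) / 6 + a * n ^ 2 / 2 by linarith
  -- If `a ≥ n / 6`, the term `a * n ^ 2 / 2` suffices alone. Otherwise the triangle inequality
  -- gives `b ≥ 5 * n / 6`, so `b - a ≥ 2 * n / 3` and the other term suffices.
  rcases le_total (n / 6) a with h | h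
  · have h1 : n / 6 * n ^ 2 ≤ a * n ^ 2 := by gcongr
    have h2 : 0 ≤ (b - a) ^ 2 * (2 * b + a) := by positivity
    nlinarith
  · have h1 : (2 * n / 3) ^ 2 * (5 * n / 3) ≤ (b - a) ^ 2 * (2 * b + a) := by
      gcongr <;> linarith
    have h2 : 0 ≤ a * n ^ 2 := by positivity
    have h3 : 0 ≤ n ^ 3 := by positivity
    nlinarith

/-- Strong monotonicity of degree three of `x ↦ ‖x‖ x`. -/
theorem norm_cube_le_inner_norm_smul_sub (x y : E) :
    ‖y - x‖ ^ 3 / 6 ≤ ⟪‖y‖ • y - ‖x‖ • x, y - x⟫_ℝ := by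
  have h1 := cube_norm_uniform_convex x y
  have h2 := cube_norm_uniform_convex y x
  rw [norm_sub_rev x y, ← neg_sub y x, inner_neg_right] at h2
  rw [inner_sub_left, real_inner_smul_left, real_inner_smul_left]
  linarith

/-- The derivative of `x ↦ ‖x‖ x`. -/
noncomputable def normSmulDeriv (x : E) : E →L[ℝ] E :=
  ‖x‖ • ContinuousLinearMap.id ℝ E + (innerSL ℝ x).smulRight (‖x‖⁻¹ • x)

theorem normSmulDeriv_apply (x h : E) :
    normSmulDeriv x h = ‖x‖ • h + ⟪x, h⟫_ℝ • ‖x‖⁻¹ • x := by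
  simp [normSmulDeriv]

theorem hasFDerivAt_norm_smul (x : E) :
    HasFDerivAt (fun y : E => ‖y‖ • y) (normSmulDeriv x) x := by
  by_cases hx : x = 0
  · subst hx
    -- The convention `0⁻¹ = 0` makes the formula give the correct derivative at the origin, where
    -- `‖y‖ • y` is `o(‖y‖)`.
    have h0 : normSmulDeriv (0 : E) = 0 := by ext h; simp [normSmulDeriv_apply]
    rw [h0]
    refine HasFDerivAt.of_isLittleO ?_
    simp only [norm_zero, smul_zero, sub_zero, zero_apply]
    rw [Asymptotics.isLittleO_iff]
    intro c hc
    filter_upwards [Metric.ball_mem_nhds (0 : E) hc] with y hy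
    rw [norm_smul, norm_norm]
    have : ‖y‖ ≤ c := by simpa using (mem_ball_zero_iff.1 hy).le
    gcongr
  · have hn : HasFDerivAt (fun y : E => ‖y‖) (‖x‖⁻¹ • innerSL ℝ x) x := by
      have h2 := (hasStrictFDerivAt_norm_sq x).hasFDerivAt.sqrt
        (pow_ne_zero 2 (norm_ne_zero_iff.2 hx))
      simp only [Real.sqrt_sq (norm_nonneg _)] at h2
      refine h2.congr_fderiv ?_
      ext h
      simp
      field_simp
    refine (hn.smul (hasFDerivAt_id x)).congr_fderiv ?_
    ext h
    simp [normSmulDeriv_apply, smul_smul, mul_comm]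

/-- The direction `‖x‖⁻¹ • x` is not Lipschitz near `0`, but its difference enters only with the
factor `‖y‖`, and that product is at most `2 * ‖x - y‖`. The other two terms of the splitting
contribute `1` each to the constant `4`. -/
theorem norm_normSmulDeriv_sub_le (x y : E) :
    ‖normSmulDeriv x - normSmulDeriv y‖ ≤ 4 * ‖x - y‖ := by
  refine ContinuousLinearMap.opNorm_le_bound _ (by positivity) fun h => ?_
  have hu : ∀ z : E, ‖‖z‖⁻¹ • z‖ ≤ 1 := by
    intro z
    rw [norm_smul, norm_inv, norm_norm]
    exact inv_mul_le_one
  have hd : ‖y‖ * ‖‖x‖⁻¹ • x - ‖y‖⁻¹ • y‖ ≤ 2 * ‖x - y‖ := by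
    by_cases hy : y = 0
    · simp [hy]
    have hid : ‖y‖ • (‖x‖⁻¹ • x - ‖y‖⁻¹ • y) = (‖y‖ - ‖x‖) • ‖x‖⁻¹ • x + (x - y) := by
      have hy' := norm_ne_zero_iff.2 hy
      by_cases hx : x = 0
      · subst hx; simp [smul_smul, hy']
      have hx' := norm_ne_zero_iff.2 hx
      rw [smul_sub, sub_smul, smul_smul, smul_smul, smul_smul, mul_inv_cancel₀ hx',
        mul_inv_cancel₀ hy']
      module
    calc ‖y‖ * ‖‖x‖⁻¹ • x - ‖y‖⁻¹ • y‖ = ‖‖y‖ • (‖x‖⁻¹ • x - ‖y‖⁻¹ • y)‖ := by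
          rw [norm_smul, norm_norm]
      _ ≤ ‖(‖y‖ - ‖x‖) • ‖x‖⁻¹ • x‖ + ‖x - y‖ := by rw [hid]; exact norm_add_le _ _
      _ ≤ ‖x - y‖ * 1 + ‖x - y‖ := by
          rw [norm_smul]
          gcongr
          · rw [norm_sub_rev x y]; exact abs_norm_sub_norm_le y x
          · exact hu x
      _ = 2 * ‖x - y‖ := by ring
  have hsplit : (normSmulDeriv x - normSmulDeriv y) h =
      (‖x‖ - ‖y‖) • h + ⟪x - y, h⟫_ℝ • ‖x‖⁻¹ • x + ⟪y, h⟫_ℝ • (‖x‖⁻¹ • x - ‖y‖⁻¹ • y) := by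
    rw [sub_apply, normSmulDeriv_apply, normSmulDeriv_apply, inner_sub_left]
    module
  rw [hsplit]
  have h1 : ‖(‖x‖ - ‖y‖) • h‖ ≤ ‖x - y‖ * ‖h‖ := by
    rw [norm_smul]; gcongr; exact abs_norm_sub_norm_le x y
  have h2 : ‖⟪x - y, h⟫_ℝ • ‖x‖⁻¹ • x‖ ≤ ‖x - y‖ * ‖h‖ := by
    rw [norm_smul]
    exact (mul_le_of_le_one_right (norm_nonneg _) (hu x)).trans (norm_inner_le_norm _ _)
  have h3 : ‖⟪y, h⟫_ℝ • (‖x‖⁻¹ • x - ‖y‖⁻¹ • y)‖ ≤ 2 * ‖x - y‖ * ‖h‖ := by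
    rw [norm_smul]
    calc _ ≤ (‖y‖ * ‖h‖) * ‖‖x‖⁻¹ • x - ‖y‖⁻¹ • y‖ := by gcongr; exact norm_inner_le_norm _ _
      _ = (‖y‖ * ‖‖x‖⁻¹ • x - ‖y‖⁻¹ • y‖) * ‖h‖ := by ring
      _ ≤ _ := by gcongr
  refine (norm_add₃_le).trans ?_
  linarith

theorem inner_normSmulDeriv_comm (x u v : E) :
    ⟪normSmulDeriv x u, v⟫_ℝ = ⟪u, normSmulDeriv x v⟫_ℝ := by
  simp only [normSmulDeriv_apply, inner_add_left, inner_add_right, real_inner_smul_left,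
    real_inner_smul_right, real_inner_comm u x]
  ring

theorem inner_normSmulDeriv_self_nonneg (x u : E) : 0 ≤ ⟪normSmulDeriv x u, u⟫_ℝ := by
  simp only [normSmulDeriv_apply, inner_add_left, real_inner_smul_left,
    real_inner_self_eq_norm_sq]
  have : 0 ≤ ⟪x, u⟫_ℝ * (‖x‖⁻¹ * ⟪x, u⟫_ℝ) := by
    rw [mul_left_comm]; exact mul_nonneg (by positivity) (mul_self_nonneg _)
  positivity

theorem hasFDerivAt_norm_pow_three (x : E) :
    HasFDerivAt (fun y : E => ‖y‖ ^ 3) ((3 * ‖x‖) • innerSL ℝ x) x := by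
  have h := hasFDerivAt_norm_rpow x (show (1 : ℝ) < 3 by norm_num)
  have h32 : (3 : ℝ) - 2 = 1 := by norm_num
  rw [h32, Real.rpow_one] at h
  refine h.congr_of_eventuallyEq (Filter.Eventually.of_forall fun y => ?_)
  norm_cast

/-- The cubic regularized Newton step exists. -/
theorem crnOracle_nonempty [FiniteDimensional ℝ E] {M : ℝ} (hM : 0 < M) (F : E → E) (zbar : E)
    {H : E →L[ℝ] E} (hsymm : ∀ u v, ⟪H u, v⟫_ℝ = ⟪u, H v⟫_ℝ) (hpos : ∀ u, 0 ≤ ⟪H u, u⟫_ℝ) :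
    (crnOracle M F zbar H).Nonempty := by
  -- The cubic model: it is coercive because `H` is positive semidefinite, and its stationarity
  -- condition is exactly the CRN equation, `M / 6 * ‖h‖ ^ 3` having gradient `(M / 2 * ‖h‖) • h`.
  let ψ : E → ℝ := fun h => ⟪F zbar, h⟫_ℝ + 1 / 2 * ⟪H h, h⟫_ℝ + M / 6 * ‖h‖ ^ 3
  have hcont : Continuous ψ := by fun_prop
  obtain ⟨w, hw⟩ := exists_forall_le_of_cubic_le hcont 0 (a := 0) (b := ‖F zbar‖)
    (c := M / 6) (by positivity) (fun y => by
      have h1 := neg_le_of_abs_le (abs_real_inner_le_norm (F zbar) y)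
      have h2 := hpos y
      simp only [ψ, sub_zero]
      linarith)
  have hderiv : HasFDerivAt ψ (innerSL ℝ (F zbar + H w + (M / 2 * ‖w‖) • w)) w := by
    have h1 : HasFDerivAt (fun h : E => ⟪F zbar, h⟫_ℝ) (innerSL ℝ (F zbar)) w :=
      (innerSL ℝ (F zbar)).hasFDerivAt
    have h2 := (H.hasFDerivAt (x := w)).inner ℝ (hasFDerivAt_id w)
    have h3 := hasFDerivAt_norm_pow_three w
    refine ((h1.add (h2.const_mul (1 / 2))).add (h3.const_mul (M / 6))).congr_fderiv ?_
    ext h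
    simp [fderivInnerCLM_apply]
    rw [hsymm h w, real_inner_comm h (H w)]
    ring
  have hzero : innerSL ℝ (F zbar + H w + (M / 2 * ‖w‖) • w) = 0 :=
    IsLocalMin.hasFDerivAt_eq_zero (Filter.Eventually.of_forall hw) hderiv
  refine ⟨zbar + w, ?_⟩
  have hz : F zbar + H w + (M / 2 * ‖w‖) • w = 0 := by
    rw [← norm_eq_zero, ← innerSL_apply_norm (𝕜 := ℝ), hzero, norm_zero]
  simpa [crnOracle] using hz

end NormPower

/-! ### Uniform convexity and smoothness of the proximal function. -/

section Prox

variable {E : Type*} [NormedAddCommGroup E] [InnerProductSpace ℝ E] [CompleteSpace E]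

/-- `g` is uniformly convex of degree three with parameter `γ`, and its Hessian is symmetric,
positive semidefinite and `Λ`-Lipschitz. -/
structure CubicallyConvex (γ Λ : ℝ) (g : E → ℝ) : Prop where
  continuous : Continuous g
  le_sub : ∀ x y : E, g x + ⟪gradient g x, y - x⟫_ℝ + γ / 12 * ‖y - x‖ ^ 3 ≤ g y
  hess_lipschitz : ∀ x y : E, ‖hess g x - hess g y‖ ≤ Λ * ‖x - y‖
  gradient_taylor : ∀ x y : E,
    ‖gradient g y - gradient g x - hess g x (y - x)‖ ≤ Λ * ‖y - x‖ ^ 2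
  hess_symm : ∀ x u v : E, ⟪hess g x u, v⟫_ℝ = ⟪u, hess g x v⟫_ℝ
  hess_nonneg : ∀ x u : E, 0 ≤ ⟪hess g x u, u⟫_ℝ

theorem HasLipschitzHessian.differentiable {L : ℝ} {f : E → ℝ} (hf : HasLipschitzHessian L f) :
    Differentiable ℝ f := hf.1.differentiable (by norm_num)

theorem differentiable_gradient {f : E → ℝ} (hf : ContDiff ℝ 2 f) :
    Differentiable ℝ (gradient f) := by
  have h1 : Differentiable ℝ (fderiv ℝ f) :=
    (hf.fderiv_right (m := 1) (by norm_num)).differentiable (by norm_num)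
  exact fun z => (InnerProductSpace.toDual ℝ E).symm.toContinuousLinearEquiv.differentiableAt.comp z
    (h1 z)

/-- Translates the derivative of the gradient into the second Fréchet derivative, whose symmetry is
then available. -/
theorem inner_hess_apply {f : E → ℝ} (hf : ContDiff ℝ 2 f) (z u v : E) :
    ⟪hess f z u, v⟫_ℝ = fderiv ℝ (fderiv ℝ f) z u v := by
  have h1 : Differentiable ℝ (fderiv ℝ f) :=
    (hf.fderiv_right (m := 1) (by norm_num)).differentiable (by norm_num)
  have h2 : HasFDerivAt (fun x => ⟪v, gradient f x⟫_ℝ) ((innerSL ℝ v).comp (hess f z)) z :=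
    (innerSL ℝ v).hasFDerivAt.comp z (differentiable_gradient hf z).hasFDerivAt
  have h3 : HasFDerivAt (fun x => fderiv ℝ f x v) ((fderiv ℝ (fderiv ℝ f) z).flip v) z := by
    simpa using (h1 z).hasFDerivAt.clm_apply (hasFDerivAt_const v z)
  have he : (fun x => ⟪v, gradient f x⟫_ℝ) = fun x => fderiv ℝ f x v := by
    ext x
    rw [real_inner_comm, inner_gradient_left]
  rw [he] at h2
  have := congrArg (fun φ => φ u) (h2.unique h3)
  rw [real_inner_comm]
  simpa using this

theorem inner_hess_comm {f : E → ℝ} (hf : ContDiff ℝ 2 f) (z u v : E) :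
    ⟪hess f z u, v⟫_ℝ = ⟪u, hess f z v⟫_ℝ := by
  rw [inner_hess_apply hf, real_inner_comm, inner_hess_apply hf]
  exact (hf.contDiffAt.isSymmSndFDerivAt (by simp)) u v

/-- Convexity makes the gradient monotone, so its component along `u` is a monotone function on the
line through `z`; the quadratic form is the derivative of this function. -/
theorem inner_hess_self_nonneg {f : E → ℝ} (hf : ContDiff ℝ 2 f) (hc : ConvexOn ℝ Set.univ f)
    (z u : E) : 0 ≤ ⟪hess f z u, u⟫_ℝ := by
  have hd : Differentiable ℝ f := hf.differentiable (by norm_num)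
  have hmono : ∀ x y : E, 0 ≤ ⟪gradient f y - gradient f x, y - x⟫_ℝ := by
    intro x y
    have h1 := convexOn_add_inner_gradient_le hc hd x y
    have h2 := convexOn_add_inner_gradient_le hc hd y x
    rw [← neg_sub y x, inner_neg_right] at h2
    rw [inner_sub_left]
    linarith
  have h1 : HasDerivAt (fun t : ℝ => z + t • u) u 0 := by
    simpa using ((hasDerivAt_id (0 : ℝ)).smul_const u).const_add z
  have h2 : HasFDerivAt (gradient f) (hess f z) (z + (0 : ℝ) • u) := by
    rw [zero_smul, add_zero]
    exact (differentiable_gradient hf z).hasFDerivAt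
  have h3 : HasDerivAt (fun t : ℝ => ⟪gradient f (z + t • u), u⟫_ℝ) ⟪hess f z u, u⟫_ℝ 0 := by
    simpa using (h2.comp_hasDerivAt (0 : ℝ) h1).inner ℝ (hasDerivAt_const (0 : ℝ) u)
  have hm : Monotone (fun t : ℝ => ⟪gradient f (z + t • u), u⟫_ℝ) := by
    intro s t hst
    rcases hst.eq_or_lt with rfl | hlt
    · exact le_rfl
    have h := hmono (z + s • u) (z + t • u)
    have he : z + t • u - (z + s • u) = (t - s) • u := by module
    rw [he, real_inner_smul_right, inner_sub_left] at h
    have := nonneg_of_mul_nonneg_right h (sub_pos.2 hlt)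
    simpa using this
  rw [← h3.deriv]
  exact hm.deriv_nonneg

variable {f : E → ℝ} {L γ : ℝ}

theorem gradient_proxFun (hf : Differentiable ℝ f) (γ : ℝ) (zbar : E) :
    gradient (proxFun f γ zbar) =
      fun z => gradient f z + γ • (‖z - zbar‖ • (z - zbar)) := by
  refine gradient_eq fun z => ?_
  have h1 : HasFDerivAt f (innerSL ℝ (gradient f z)) z := by
    have := (hf z).hasGradientAt
    rw [hasGradientAt_iff_hasFDerivAt] at this
    exact this
  have h2 : HasFDerivAt (fun z : E => ‖z - zbar‖ ^ 3)
      ((3 * ‖z - zbar‖) • innerSL ℝ (z - zbar)) z :=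
    (hasFDerivAt_comp_sub zbar).2 (hasFDerivAt_norm_pow_three (z - zbar))
  rw [hasGradientAt_iff_hasFDerivAt]
  refine (h1.add (h2.const_mul (γ / 3))).congr_fderiv ?_
  ext h
  simp
  ring

theorem hasFDerivAt_gradient_proxFun (hf : ContDiff ℝ 2 f) (γ : ℝ) (zbar z : E) :
    HasFDerivAt (gradient (proxFun f γ zbar)) (hess f z + γ • normSmulDeriv (z - zbar)) z := by
  rw [gradient_proxFun (hf.differentiable (by norm_num))]
  have h2 : HasFDerivAt (fun z : E => ‖z - zbar‖ • (z - zbar)) (normSmulDeriv (z - zbar)) z :=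
    (hasFDerivAt_comp_sub zbar).2 (hasFDerivAt_norm_smul (z - zbar))
  exact (differentiable_gradient hf z).hasFDerivAt.add (h2.const_smul γ)

theorem hess_proxFun (hf : ContDiff ℝ 2 f) (γ : ℝ) (zbar z : E) :
    hess (proxFun f γ zbar) z = hess f z + γ • normSmulDeriv (z - zbar) :=
  (hasFDerivAt_gradient_proxFun hf γ zbar z).fderiv

/-- The proximal function of a convex function with Lipschitz Hessian is uniformly convex. -/
theorem cubicallyConvex_proxFun (hL : 0 ≤ L) (hγ : 0 ≤ γ) (hf : HasLipschitzHessian L f)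
    (hc : ConvexOn ℝ Set.univ f) (zbar : E) :
    CubicallyConvex γ (L + 4 * γ) (proxFun f γ zbar) := by
  have hlip : ∀ x y : E, ‖hess (proxFun f γ zbar) x - hess (proxFun f γ zbar) y‖ ≤
      (L + 4 * γ) * ‖x - y‖ := by
    intro x y
    rw [hess_proxFun hf.1, hess_proxFun hf.1]
    have he : hess f x + γ • normSmulDeriv (x - zbar) - (hess f y + γ • normSmulDeriv (y - zbar))
        = (hess f x - hess f y) + γ • (normSmulDeriv (x - zbar) - normSmulDeriv (y - zbar)) := by
      module
    rw [he]
    refine (norm_add_le _ _).trans ?_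
    have h1 := hf.2 x y
    have h2 := norm_normSmulDeriv_sub_le (x - zbar) (y - zbar)
    rw [sub_sub_sub_cancel_right] at h2
    rw [norm_smul, Real.norm_of_nonneg hγ]
    nlinarith
  refine ⟨?_, fun x y => ?_, hlip, fun x y => ?_, fun x u v => ?_, fun x u => ?_⟩
  · have := hf.1.continuous
    unfold proxFun
    fun_prop
  · have h1 := convexOn_add_inner_gradient_le hc hf.differentiable x y
    have h2 := cube_norm_uniform_convex (x - zbar) (y - zbar)
    rw [sub_sub_sub_cancel_right] at h2
    rw [gradient_proxFun hf.differentiable, inner_add_left, real_inner_smul_left,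
      real_inner_smul_left]
    have h3 := mul_le_mul_of_nonneg_left h2 hγ
    simp only [proxFun]
    linarith
  · have hb : ∀ z ∈ segment ℝ x y, ‖hess (proxFun f γ zbar) z - hess (proxFun f γ zbar) x‖ ≤
        (L + 4 * γ) * ‖y - x‖ := by
      intro z hz
      refine (hlip z x).trans ?_
      have : ‖z - x‖ ≤ ‖y - x‖ := by
        obtain ⟨t, ht, rfl⟩ := (segment_eq_image_lineMap ℝ x y ▸ hz)
        rw [AffineMap.lineMap_apply_module']
        rw [add_sub_cancel_right, norm_smul, Real.norm_of_nonneg ht.1]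
        exact mul_le_of_le_one_left (norm_nonneg _) ht.2
      gcongr
    -- The mean value inequality on the segment gives the constant `Λ` instead of the sharp `Λ / 2`;
    -- only numerical factors suffer.
    have := (convex_segment x y).norm_image_sub_le_of_norm_hasFDerivWithin_le'
      (f := gradient (proxFun f γ zbar)) (φ := hess (proxFun f γ zbar) x)
      (fun z _ => by
        have := hasFDerivAt_gradient_proxFun hf.1 γ zbar z
        rw [← hess_proxFun hf.1] at this
        exact this.hasFDerivWithinAt) hb (left_mem_segment ℝ x y) (right_mem_segment ℝ x y)
    refine this.trans (le_of_eq ?_)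
    ring
  · rw [hess_proxFun hf.1]
    simp only [add_apply, smul_apply, inner_add_left, inner_add_right, real_inner_smul_left,
      real_inner_smul_right]
    rw [inner_hess_comm hf.1, inner_normSmulDeriv_comm]
  · rw [hess_proxFun hf.1]
    simp only [add_apply, smul_apply, inner_add_left, real_inner_smul_left]
    exact add_nonneg (inner_hess_self_nonneg hf.1 hc x u)
      (mul_nonneg hγ (inner_normSmulDeriv_self_nonneg _ _))

theorem CubicallyConvex.crnStep_mem [FiniteDimensional ℝ E] {g : E → ℝ} {Λ M : ℝ}
    (hg : CubicallyConvex γ Λ g) (hM : 0 < M) (x z : E) :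
    gradient g z + hess g x (crnStep M (gradient g) z (hess g x) - z) +
      (M / 2 * ‖crnStep M (gradient g) z (hess g x) - z‖) •
        (crnStep M (gradient g) z (hess g x) - z) = 0 := by
  have h := crnOracle_nonempty hM (gradient g) z (hg.hess_symm x) (hg.hess_nonneg x)
  have h' : crnStep M (gradient g) z (hess g x) ∈ crnOracle M (gradient g) z (hess g x) := by
    rw [crnStep, dif_pos h]
    exact h.some_mem
  exact h'

theorem CubicallyConvex.exists_minimizer [FiniteDimensional ℝ E] {g : E → ℝ} {Λ : ℝ}
    (hg : CubicallyConvex γ Λ g) (hγ : 0 < γ) : ∃ w, ∀ y, g w ≤ g y := by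
  refine exists_forall_le_of_cubic_le hg.continuous 0 (a := g 0) (b := ‖gradient g 0‖)
    (c := γ / 12) (by positivity) fun y => ?_
  have h1 := neg_le_of_abs_le (abs_real_inner_le_norm (gradient g 0) (y - 0))
  have h2 := hg.le_sub 0 y
  linarith

end Prox

/-! ### Real inequalities behind the lazy epochs. -/

section RealSequences

/-- A weighted sum of increments against the accumulated path length. -/
theorem sum_mul_sq_le_of_le_sum {r S : ℕ → ℝ} (hr : ∀ t, 0 ≤ r t)
    (hS : ∀ t, S t ≤ ∑ i ∈ Finset.range t, r i) (k : ℕ) :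
    ∑ t ∈ Finset.range k, S t * r t ^ 2 ≤
      2 / 3 * ((k : ℝ) - 1) * ∑ t ∈ Finset.range k, r t ^ 3 := by
  induction k with
  | zero => simp
  | succ k ih =>
    rw [Finset.sum_range_succ, Finset.sum_range_succ]
    -- Young's inequality on each product: `r i * r k ^ 2 ≤ r i ^ 3 / 3 + 2 / 3 * r k ^ 3`.
    have h1 : S k * r k ^ 2 ≤ (∑ t ∈ Finset.range k, r t ^ 3) / 3 + 2 / 3 * k * r k ^ 3 := by
      calc S k * r k ^ 2 ≤ (∑ i ∈ Finset.range k, r i) * r k ^ 2 := by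
            gcongr; exact hS k
        _ = ∑ i ∈ Finset.range k, r i * r k ^ 2 := Finset.sum_mul _ _ _
        _ ≤ ∑ i ∈ Finset.range k, (r i ^ 3 / 3 + 2 / 3 * r k ^ 3) := by
            refine Finset.sum_le_sum fun i _ => ?_
            nlinarith [mul_nonneg (sq_nonneg (r i - r k)) (hr i),
              mul_nonneg (sq_nonneg (r i - r k)) (hr k)]
        _ = _ := by
            rw [Finset.sum_add_distrib, ← Finset.sum_div, Finset.sum_const, Finset.card_range,
              nsmul_eq_mul]
            ring
    have h2 : 0 ≤ ∑ t ∈ Finset.range k, r t ^ 3 :=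
      Finset.sum_nonneg fun i _ => pow_nonneg (hr i) 3
    push_cast
    nlinarith

/-- By the power mean inequality each `S t ^ 3` is at most `m ^ 2` times the whole sum of cubes.
Hence the drift `S t / m` costs, summed over at most `m` steps, no more than the steps themselves.
-/
theorem sum_add_div_cube_le {r S : ℕ → ℝ} (hr : ∀ t, 0 ≤ r t) (hS0 : ∀ t, 0 ≤ S t)
    (hS : ∀ t, S t ≤ ∑ i ∈ Finset.range t, r i) {k m : ℕ} (hm : 1 ≤ m) (hk : k ≤ m) :
    ∑ t ∈ Finset.range k, (r t + S t / m) ^ 3 ≤ 8 * ∑ t ∈ Finset.range k, r t ^ 3 := by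
  have hm0 : (0 : ℝ) < m := by exact_mod_cast hm
  set R := ∑ t ∈ Finset.range k, r t ^ 3 with hR
  have hcube : ∀ t ∈ Finset.range k, S t ^ 3 ≤ (m : ℝ) ^ 2 * R := by
    intro t ht
    have ht' : t ≤ k := (Finset.mem_range.1 ht).le
    calc S t ^ 3 ≤ (∑ i ∈ Finset.range t, r i) ^ 3 := by gcongr; exacts [hS0 t, hS t]
      _ ≤ (∑ i ∈ Finset.range k, r i) ^ 3 := by
          have hsub := Finset.sum_le_sum_of_subset_of_nonneg (f := r)
            (Finset.range_mono ht') (fun i _ _ => hr i)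
          have := Finset.sum_nonneg (s := Finset.range t) fun i _ => hr i
          gcongr
      _ ≤ (k : ℝ) ^ 2 * R := by
          have h := pow_sum_div_card_le_sum_pow (s := Finset.range k) (f := r)
            (fun i _ => hr i) 2
          rw [Finset.card_range] at h
          rcases Nat.eq_zero_or_pos k with h0 | h0
          · subst h0; simp
          · rw [div_le_iff₀ (by positivity)] at h
            rw [mul_comm]
            exact h
      _ ≤ (m : ℝ) ^ 2 * R := by
          have : 0 ≤ R := Finset.sum_nonneg fun i _ => pow_nonneg (hr i) 3
          gcongr
  have hR0 : 0 ≤ R := Finset.sum_nonneg fun i _ => pow_nonneg (hr i) 3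
  calc ∑ t ∈ Finset.range k, (r t + S t / m) ^ 3
      ≤ ∑ t ∈ Finset.range k, (4 * r t ^ 3 + 4 * (R / m)) := by
        refine Finset.sum_le_sum fun t ht => ?_
        have h1 : (S t / m) ^ 3 ≤ R / m := by
          rw [div_pow, div_le_div_iff₀ (by positivity) hm0]
          nlinarith [hcube t ht]
        have h2 : 0 ≤ S t / m := div_nonneg (hS0 t) hm0.le
        nlinarith [hr t, mul_nonneg (sq_nonneg (r t - S t / m)) (add_nonneg (hr t) h2)]
    _ = 4 * R + 4 * ((k : ℝ) / m * R) := by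
        rw [Finset.sum_add_distrib, ← Finset.mul_sum, Finset.sum_const, Finset.card_range,
          nsmul_eq_mul]
        ring
    _ ≤ 8 * R := by
        have : (k : ℝ) / m ≤ 1 := by
          rw [div_le_one hm0]; exact_mod_cast hk
        nlinarith

/-- If every partial sum is controlled by the total decrease, then the average contracts. -/
theorem sum_le_of_sum_le_decrease {δ : ℕ → ℝ} {m : ℕ} (hm : 1 ≤ m) (h0 : 0 ≤ δ 0)
    (h : ∀ k ≤ m, ∑ t ∈ Finset.range k, δ (t + 1) ≤ 1200 * m * (δ 0 - δ k)) :
    ∑ t ∈ Finset.range m, δ (t + 1) ≤ m * ((1 - 1 / 2401) * δ 0) := by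
  have hm0 : (0 : ℝ) < m := by exact_mod_cast hm
  -- The hypothesis pushes `δ k` below `δ 0` in proportion to the sum so far, so the partial sums
  -- fall short of `k * δ 0` by a quadratic amount. The constant `2401 = 2 * 1200 + 1` makes the
  -- terms linear in `k` cancel in the induction.
  have key : ∀ k ≤ m, ∑ t ∈ Finset.range k, δ (t + 1) ≤
      δ 0 * (k - 1 / 2401 * k ^ 2 / m) := by
    intro k
    induction k with
    | zero => simp
    | succ k ih =>
      intro hk
      have hk' := ih (by omega)
      have h1 := h (k + 1) hk
      have hkm : (k : ℝ) + 1 ≤ m := by exact_mod_cast hk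
      have hk0 : (0 : ℝ) ≤ k := by positivity
      rw [Finset.sum_range_succ] at h1 ⊢
      set P := ∑ t ∈ Finset.range k, δ (t + 1)
      set Q := P + δ (k + 1)
      have h2 : (1200 * m + 1) * Q ≤ 1200 * m * (P + δ 0) := by
        simp only [Q] at h1 ⊢; linarith
      have h3 : (1200 * m + 1) * Q ≤
          1200 * m * (δ 0 * (k - 1 / 2401 * k ^ 2 / m) + δ 0) := by
        refine h2.trans ?_
        gcongr
      have h4 : 1200 * m * (δ 0 * (k - 1 / 2401 * k ^ 2 / m) + δ 0) ≤
          (1200 * m + 1) * (δ 0 * ((k + 1) - 1 / 2401 * (k + 1) ^ 2 / m)) := by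
        have he : (1200 * m + 1) * (δ 0 * ((k + 1) - 1 / 2401 * (k + 1) ^ 2 / m)) -
            1200 * m * (δ 0 * (k - 1 / 2401 * k ^ 2 / m) + δ 0) =
            δ 0 * ((k + 1) - 1200 / 2401 * (2 * k + 1) - 1 / 2401 * ((k + 1) ^ 2 / m)) := by
          field_simp
          ring
        have h5 : ((k : ℝ) + 1) ^ 2 / m ≤ k + 1 := by
          rw [div_le_iff₀ hm0]; nlinarith
        have h6 : 0 ≤ δ 0 * (((k : ℝ) + 1) - 1200 / 2401 * (2 * k + 1) -
            1 / 2401 * (((k : ℝ) + 1) ^ 2 / m)) := mul_nonneg h0 (by linarith)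
        linarith
      push_cast
      exact le_of_mul_le_mul_left (h3.trans h4) (by positivity)
  refine (key m le_rfl).trans (le_of_eq ?_)
  field_simp

end RealSequences

/-! ### CRN steps with a fresh Hessian. -/

section Solver

variable {E : Type*} [NormedAddCommGroup E] [InnerProductSpace ℝ E] [CompleteSpace E]
  {g : E → ℝ} {γ Λ : ℝ} {w : E}

namespace CubicallyConvex

theorem sub_le_inner (hg : CubicallyConvex γ Λ g) (hγ : 0 ≤ γ) (x y : E) :
    g y - g x ≤ ⟪gradient g y, y - x⟫_ℝ := by
  have h := hg.le_sub y x
  rw [← neg_sub y x, inner_neg_right, norm_neg] at h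
  have : 0 ≤ γ / 12 * ‖y - x‖ ^ 3 := by positivity
  linarith

theorem cube_le_sub_min (hg : CubicallyConvex γ Λ g) (hw : ∀ z, g w ≤ g z) (y : E) :
    γ / 12 * ‖y - w‖ ^ 3 ≤ g y - g w := by
  have h := hg.le_sub w y
  rw [gradient_eq_zero_of_forall_le hw, inner_zero_left] at h
  linarith

theorem cube_le_inner (hg : CubicallyConvex γ Λ g) (hw : ∀ z, g w ≤ g z) (y : E) :
    γ / 6 * ‖y - w‖ ^ 3 ≤ ⟪gradient g y, y - w⟫_ℝ := by
  have h := hg.le_sub y w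
  rw [← neg_sub y w, inner_neg_right, norm_neg] at h
  have := hg.cube_le_sub_min hw y
  linarith

/-- Jensen's inequality, from the tangent plane at the average, where the linear terms cancel. -/
theorem le_average (hg : CubicallyConvex γ Λ g) (hγ : 0 ≤ γ) {m : ℕ} (hm : 1 ≤ m) (z : ℕ → E) :
    m * g ((1 / (m : ℝ)) • ∑ t ∈ Finset.range m, z t) ≤ ∑ t ∈ Finset.range m, g (z t) := by
  have hm0 : (m : ℝ) ≠ 0 := by positivity
  set a := (1 / (m : ℝ)) • ∑ t ∈ Finset.range m, z t with ha
  have h1 : ∑ t ∈ Finset.range m, (g a + ⟪gradient g a, z t - a⟫_ℝ) ≤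
      ∑ t ∈ Finset.range m, g (z t) := by
    refine Finset.sum_le_sum fun t _ => ?_
    have h := hg.le_sub a (z t)
    have : 0 ≤ γ / 12 * ‖z t - a‖ ^ 3 := by positivity
    linarith
  have h2 : ∑ t ∈ Finset.range m, (z t - a) = 0 := by
    rw [Finset.sum_sub_distrib, Finset.sum_const, Finset.card_range, ha, ← Nat.cast_smul_eq_nsmul ℝ,
      smul_smul, mul_one_div_cancel hm0, one_smul, sub_self]
  rw [Finset.sum_add_distrib, ← inner_sum, h2, inner_zero_right, Finset.sum_const,
    Finset.card_range, nsmul_eq_mul, add_zero] at h1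
  exact h1

variable [FiniteDimensional ℝ E] {L : ℝ}

/-- The gradient after a CRN step with the current Hessian. -/
theorem norm_gradient_crnStep_le (hg : CubicallyConvex γ Λ g) (hL : 0 < L) (hΛ : Λ ≤ 5 * L)
    (z : E) :
    ‖gradient g (crnStep L (gradient g) z (hess g z))‖ ≤
      11 / 2 * L * ‖crnStep L (gradient g) z (hess g z) - z‖ ^ 2 := by
  have h := hg.crnStep_mem hL z z
  set y := crnStep L (gradient g) z (hess g z)
  have ht := hg.gradient_taylor z y
  have he : gradient g y = (gradient g y - gradient g z - hess g z (y - z)) -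
      (L / 2 * ‖y - z‖) • (y - z) := by
    calc gradient g y = gradient g y - 0 := (sub_zero _).symm
      _ = _ := by rw [← h]; abel
  rw [he]
  refine (norm_sub_le _ _).trans ?_
  rw [norm_smul, Real.norm_of_nonneg (by positivity)]
  nlinarith [sq_nonneg ‖y - z‖]

/-- A CRN step does not move away from the minimizer by more than a constant factor. -/
theorem norm_crnStep_sub_le (hg : CubicallyConvex γ Λ g) (hL : 0 < L) (hΛ : Λ ≤ 5 * L)
    (hw : ∀ z, g w ≤ g z) (z : E) :
    ‖crnStep L (gradient g) z (hess g z) - w‖ ≤ 9 * ‖z - w‖ := by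
  have h := hg.crnStep_mem hL z z
  set y := crnStep L (gradient g) z (hess g z)
  have ht := hg.gradient_taylor z w
  rw [gradient_eq_zero_of_forall_le hw, zero_sub] at ht
  set G := gradient g z + hess g z (w - z) + (L / 2 * ‖w - z‖) • (w - z) with hG
  have hGn : ‖G‖ ≤ 11 / 2 * L * ‖w - z‖ ^ 2 := by
    have he : G = -(-gradient g z - hess g z (w - z)) + (L / 2 * ‖w - z‖) • (w - z) := by
      rw [hG]; abel
    rw [he]
    refine (norm_add_le _ _).trans ?_
    rw [norm_smul, Real.norm_of_nonneg (by positivity), norm_neg]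
    nlinarith [sq_nonneg ‖w - z‖]
  have hmono : L / 12 * ‖w - y‖ ^ 3 ≤ ⟪G, w - y⟫_ℝ := by
    have h1 := norm_cube_le_inner_norm_smul_sub (y - z) (w - z)
    have h2 := hg.hess_nonneg z (w - y)
    rw [sub_sub_sub_cancel_right] at h1
    have he : G = hess g z (w - y) + (L / 2) • (‖w - z‖ • (w - z) - ‖y - z‖ • (y - z)) := by
      have hs : hess g z (w - y) = hess g z (w - z) - hess g z (y - z) := by
        rw [← map_sub, sub_sub_sub_cancel_right]
      rw [hs, ← sub_zero G, ← h, hG]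
      module
    rw [he, inner_add_left, real_inner_smul_left]
    nlinarith
  have hcs := real_inner_le_norm G (w - y)
  rw [norm_sub_rev y w, norm_sub_rev z w]
  rcases (norm_nonneg (w - y)).eq_or_lt with h0 | h0
  · rw [← h0]; positivity
  have h1 : L / 12 * ‖w - y‖ ^ 2 ≤ 11 / 2 * L * ‖w - z‖ ^ 2 := by
    refine le_trans ?_ hGn
    refine le_of_mul_le_mul_right (le_trans (le_of_eq ?_) (hmono.trans hcs)) h0
    ring
  refine le_of_sq_le_sq ?_ (by positivity)
  refine le_of_mul_le_mul_left ?_ hL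
  nlinarith [sq_nonneg ‖w - z‖, mul_nonneg hL.le (sq_nonneg ‖w - z‖)]

end CubicallyConvex

end Solver

/-! ### Lazy epochs and the Monteiro–Svaiter condition. -/

section Epoch

variable {E : Type*} [NormedAddCommGroup E] [InnerProductSpace ℝ E] [CompleteSpace E]
  [FiniteDimensional ℝ E] {g : E → ℝ} {γ Λ M B : ℝ} {m : ℕ} {w : E}

namespace CubicallyConvex

/-- The gradient after a lazy CRN step, up to the regularization term. -/
theorem norm_gradient_lazyIterate_add_le (hg : CubicallyConvex γ Λ g) (hM : 0 < M)
    (zs : E) (t : ℕ) :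
    ‖gradient g (lazyIterate g M zs (t + 1)) +
        (M / 2 * ‖lazyIterate g M zs (t + 1) - lazyIterate g M zs t‖) •
          (lazyIterate g M zs (t + 1) - lazyIterate g M zs t)‖ ≤
      Λ * (‖lazyIterate g M zs (t + 1) - lazyIterate g M zs t‖ +
        ‖lazyIterate g M zs t - zs‖) * ‖lazyIterate g M zs (t + 1) - lazyIterate g M zs t‖ := by
  have h := hg.crnStep_mem hM zs (lazyIterate g M zs t)
  change gradient g (lazyIterate g M zs t) + hess g zs (lazyIterate g M zs (t + 1) -
    lazyIterate g M zs t) + (M / 2 * ‖lazyIterate g M zs (t + 1) - lazyIterate g M zs t‖) •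
      (lazyIterate g M zs (t + 1) - lazyIterate g M zs t) = 0 at h
  generalize lazyIterate g M zs (t + 1) = y at *
  generalize lazyIterate g M zs t = z at *
  -- The error is a Taylor remainder plus the effect of the stale Hessian.
  have he : gradient g y + (M / 2 * ‖y - z‖) • (y - z) =
      (gradient g y - gradient g z - hess g z (y - z)) + (hess g z - hess g zs) (y - z) := by
    rw [← sub_zero (gradient g y + _), ← h, sub_apply]
    abel
  rw [he]
  refine (norm_add_le _ _).trans ?_
  have h1 := hg.gradient_taylor z y
  have h2 : ‖(hess g z - hess g zs) (y - z)‖ ≤ Λ * ‖z - zs‖ * ‖y - z‖ :=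
    (ContinuousLinearMap.le_opNorm _ _).trans (by gcongr; exact hg.hess_lipschitz z zs)
  linarith

/-- Convexity at the new point bounds the change of `g` by the inner product of the new gradient
with the step. The regularization contributes `-M / 2 = -3 * m * B` times the cubed step, and the
remaining terms are the errors of the Taylor model and of the snapshot. -/
theorem lazyIterate_decrease (hg : CubicallyConvex γ Λ g) (hγ : 0 ≤ γ) (hB : 0 < B) (hm : 1 ≤ m)
    (hΛ : Λ ≤ 2 * B) (hM : M = 6 * m * B) (zs : E) (t : ℕ) :
    g (lazyIterate g M zs (t + 1)) ≤ g (lazyIterate g M zs t) -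
      (3 * m - 2) * B * ‖lazyIterate g M zs (t + 1) - lazyIterate g M zs t‖ ^ 3 +
      2 * B * (‖lazyIterate g M zs t - zs‖ *
        ‖lazyIterate g M zs (t + 1) - lazyIterate g M zs t‖ ^ 2) := by
  have hm0 : (0 : ℝ) < m := by exact_mod_cast hm
  have hM0 : 0 < M := by rw [hM]; positivity
  have h1 := hg.norm_gradient_lazyIterate_add_le hM0 zs t
  generalize lazyIterate g M zs (t + 1) = y at *
  generalize lazyIterate g M zs t = z at *
  have h2 := hg.sub_le_inner hγ z y
  have h3 := real_inner_le_norm (gradient g y + (M / 2 * ‖y - z‖) • (y - z)) (y - z)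
  rw [inner_add_left, real_inner_smul_left, real_inner_self_eq_norm_sq] at h3
  have h4 : ‖gradient g y + (M / 2 * ‖y - z‖) • (y - z)‖ * ‖y - z‖ ≤
      2 * B * (‖y - z‖ + ‖z - zs‖) * ‖y - z‖ * ‖y - z‖ := by
    gcongr
    exact h1.trans (by gcongr)
  subst hM
  nlinarith

/-- The new gradient is at most `15 * m ^ 2 * γ * x ^ 2`, with `x` the step plus `1 / m` times the
drift. Uniform convexity turns this into distance at most `10 * m * x` from the minimizer, and the
gap is at most gradient times distance. -/
theorem sub_min_lazyIterate_le (hg : CubicallyConvex γ Λ g) (hγ : 0 < γ) (hB : 0 < B) (hm : 1 ≤ m)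
    (hΛ : Λ ≤ 2 * B) (hM : M = 6 * m * B) (hBγ : B ≤ 3 * m * γ) (hw : ∀ z, g w ≤ g z)
    (zs : E) (t : ℕ) :
    g (lazyIterate g M zs (t + 1)) - g w ≤ 150 * m ^ 3 * γ *
      (‖lazyIterate g M zs (t + 1) - lazyIterate g M zs t‖ +
        ‖lazyIterate g M zs t - zs‖ / m) ^ 3 := by
  have hm1 : (1 : ℝ) ≤ m := by exact_mod_cast hm
  have hm0 : (0 : ℝ) < m := by linarith
  have hM0 : 0 < M := by rw [hM]; positivity
  have h1 := hg.norm_gradient_lazyIterate_add_le hM0 zs t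
  generalize lazyIterate g M zs (t + 1) = y at *
  generalize lazyIterate g M zs t = z at *
  have hr := norm_nonneg (y - z)
  have hS : 0 ≤ ‖z - zs‖ / m := by positivity
  have hSm : ‖z - zs‖ = m * (‖z - zs‖ / m) := by field_simp
  have h5 : ‖gradient g y‖ ≤ ‖gradient g y + (M / 2 * ‖y - z‖) • (y - z)‖ +
      M / 2 * ‖y - z‖ * ‖y - z‖ := by
    have := norm_sub_le (gradient g y + (M / 2 * ‖y - z‖) • (y - z))
      ((M / 2 * ‖y - z‖) • (y - z))
    rwa [add_sub_cancel_right, norm_smul, Real.norm_of_nonneg (by positivity)] at this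
  have h6 : Λ * (‖y - z‖ + ‖z - zs‖) * ‖y - z‖ ≤ 2 * B * (‖y - z‖ + ‖z - zs‖) * ‖y - z‖ := by
    gcongr
  have hF : ‖gradient g y‖ ≤ 15 * m ^ 2 * γ * (‖y - z‖ + ‖z - zs‖ / m) ^ 2 := by
    rw [hSm] at h6 h1
    rw [hM] at h5
    generalize ‖y - z‖ = r at *
    generalize ‖z - zs‖ / m = s at *
    have h7 : ‖gradient g y‖ ≤ 5 * m * B * (r + s) ^ 2 := by
      have e1 : 2 * B * (r + m * s) * r + 6 * m * B / 2 * r * r ≤ 5 * m * B * (r + s) ^ 2 := by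
        have f1 : 0 ≤ B * (m - 1) * r ^ 2 := by
          have : 0 ≤ (m : ℝ) - 1 := by linarith
          positivity
        have f2 : 0 ≤ m * B * (r * s) := by positivity
        have f3 : 0 ≤ m * B * s ^ 2 := by positivity
        nlinarith
      rw [hM] at h1
      linarith
    have h8 : 5 * m * B * (r + s) ^ 2 ≤ 5 * m * (3 * m * γ) * (r + s) ^ 2 := by gcongr
    nlinarith
  have hx : 0 ≤ ‖y - z‖ + ‖z - zs‖ / m := by positivity
  generalize ‖y - z‖ + ‖z - zs‖ / m = x at *
  have hc := real_inner_le_norm (gradient g y) (y - w)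
  have hu := hg.cube_le_inner hw y
  have hρ : ‖y - w‖ ≤ 10 * m * x := by
    rcases (norm_nonneg (y - w)).eq_or_lt with h0 | h0
    · rw [← h0]; positivity
    have h7 : γ / 6 * ‖y - w‖ ^ 2 ≤ ‖gradient g y‖ := by
      refine le_of_mul_le_mul_right (le_trans (le_of_eq ?_) (hu.trans hc)) h0
      ring
    refine le_of_sq_le_sq ?_ (by positivity)
    refine le_of_mul_le_mul_left ?_ hγ
    have : 0 ≤ γ * (m ^ 2 * x ^ 2) := by positivity
    nlinarith
  calc g y - g w ≤ ⟪gradient g y, y - w⟫_ℝ := hg.sub_le_inner hγ.le w y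
    _ ≤ ‖gradient g y‖ * ‖y - w‖ := hc
    _ ≤ (15 * m ^ 2 * γ * x ^ 2) * (10 * m * x) := by gcongr
    _ = _ := by ring

/-- Gaps and decrease are both compared with the sum `R` of the cubed steps: the gaps sum to at most
`1200 * m ^ 3 * γ * R`. The decrease is at least `m * B * R`, since `(3 * m - 2) - 2 * (m - 1) = m`.
-/
theorem sum_sub_min_lazyIterate_le (hg : CubicallyConvex γ Λ g) (hγ : 0 < γ) (hm : 1 ≤ m)
    (hΛ : Λ ≤ 2 * B) (hM : M = 6 * m * B) (hγB : m * γ ≤ B) (hBγ : B ≤ 3 * m * γ)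
    (hw : ∀ z, g w ≤ g z) (zs : E) {k : ℕ} (hk : k ≤ m) :
    ∑ t ∈ Finset.range k, (g (lazyIterate g M zs (t + 1)) - g w) ≤
      1200 * m * ((g (lazyIterate g M zs 0) - g w) - (g (lazyIterate g M zs k) - g w)) := by
  have hm1 : (1 : ℝ) ≤ m := by exact_mod_cast hm
  have hm0 : (0 : ℝ) < m := by linarith
  have hB : 0 < B := lt_of_lt_of_le (by positivity) hγB
  set z : ℕ → E := lazyIterate g M zs with hz
  set r : ℕ → ℝ := fun t => ‖z (t + 1) - z t‖ with hr
  set S : ℕ → ℝ := fun t => ‖z t - zs‖ with hS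
  have hr0 : ∀ t, 0 ≤ r t := fun t => norm_nonneg _
  have hS0 : ∀ t, 0 ≤ S t := fun t => norm_nonneg _
  have hSr : ∀ t, S t ≤ ∑ i ∈ Finset.range t, r i := by
    intro t
    have h1 : z t - zs = ∑ i ∈ Finset.range t, (z (i + 1) - z i) := by
      rw [Finset.sum_range_sub]; rfl
    simp only [hS, h1]
    exact norm_sum_le _ _
  set R := ∑ t ∈ Finset.range k, r t ^ 3 with hR
  have hR0 : 0 ≤ R := Finset.sum_nonneg fun i _ => pow_nonneg (hr0 i) 3
  have h1 : ∑ t ∈ Finset.range k, (g (z (t + 1)) - g w) ≤ 1200 * m ^ 3 * γ * R := by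
    calc _ ≤ ∑ t ∈ Finset.range k, 150 * m ^ 3 * γ * (r t + S t / m) ^ 3 :=
          Finset.sum_le_sum fun t _ => hg.sub_min_lazyIterate_le hγ hB hm hΛ hM hBγ hw zs t
      _ = 150 * m ^ 3 * γ * ∑ t ∈ Finset.range k, (r t + S t / m) ^ 3 := by
          rw [Finset.mul_sum]
      _ ≤ 150 * m ^ 3 * γ * (8 * R) := by
          gcongr
          exact sum_add_div_cube_le hr0 hS0 hSr hm hk
      _ = _ := by ring
  have h2 : g (z k) ≤ g (z 0) - m * B * R := by
    have h3 : ∑ t ∈ Finset.range k, (g (z (t + 1)) - g (z t)) ≤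
        ∑ t ∈ Finset.range k, (-((3 * m - 2) * B) * r t ^ 3 + 2 * B * (S t * r t ^ 2)) := by
      refine Finset.sum_le_sum fun t _ => ?_
      have := hg.lazyIterate_decrease hγ.le hB hm hΛ hM zs t
      simp only [hr, hS, hz]
      linarith
    rw [Finset.sum_range_sub (fun t => g (z t)), Finset.sum_add_distrib, ← Finset.mul_sum,
      ← Finset.mul_sum] at h3
    have h4 := sum_mul_sq_le_of_le_sum hr0 hSr k
    have h5 : 2 / 3 * ((k : ℝ) - 1) * R ≤ (m - 1) * R := by
      gcongr
      have : (k : ℝ) ≤ m := by exact_mod_cast hk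
      linarith
    have h6 : B * ∑ t ∈ Finset.range k, S t * r t ^ 2 ≤ B * ((m - 1) * R) := by
      gcongr; exact h4.trans h5
    nlinarith
  have h3 : m ^ 2 * γ * R ≤ m * B * R := by
    have : (m : ℝ) ^ 2 * γ = m * (m * γ) := by ring
    rw [this]
    gcongr
  calc _ ≤ 1200 * m ^ 3 * γ * R := h1
    _ = 1200 * m * (m ^ 2 * γ * R) := by ring
    _ ≤ _ := by
      gcongr
      linarith

/-- One lazy epoch contracts the optimality gap. -/
theorem sub_min_lazyEpoch_le (hg : CubicallyConvex γ Λ g) (hγ : 0 < γ) (hm : 1 ≤ m)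
    (hΛ : Λ ≤ 2 * B) (hM : M = 6 * m * B) (hγB : m * γ ≤ B) (hBγ : B ≤ 3 * m * γ)
    (hw : ∀ z, g w ≤ g z) (zs : E) :
    g (lazyEpoch g M m zs) - g w ≤ (1 - 1 / 2401) * (g zs - g w) := by
  have hm0 : (0 : ℝ) < m := by exact_mod_cast hm
  have h1 := sum_le_of_sum_le_decrease (δ := fun t => g (lazyIterate g M zs t) - g w) hm
    (sub_nonneg.2 (hw _))
    (fun k hk => hg.sum_sub_min_lazyIterate_le hγ hm hΛ hM hγB hBγ hw zs hk)
  have h2 := hg.le_average hγ.le hm (fun t => lazyIterate g M zs (t + 1))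
  have h3 : lazyEpoch g M m zs =
      (1 / (m : ℝ)) • ∑ t ∈ Finset.range m, lazyIterate g M zs (t + 1) := by
    rw [lazyEpoch, Finset.range_eq_Ico, Finset.sum_Ico_add']
    rfl
  rw [← h3] at h2
  rw [Finset.sum_sub_distrib, Finset.sum_const, Finset.card_range, nsmul_eq_mul] at h1
  refine le_of_mul_le_mul_left ?_ hm0
  have h4 : lazyIterate g M zs 0 = zs := rfl
  simp only [h4] at h1
  linarith

theorem sub_min_iterate_lazyEpoch_le (hg : CubicallyConvex γ Λ g) (hγ : 0 < γ) (hm : 1 ≤ m)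
    (hΛ : Λ ≤ 2 * B) (hM : M = 6 * m * B) (hγB : m * γ ≤ B) (hBγ : B ≤ 3 * m * γ)
    (hw : ∀ z, g w ≤ g z) (zs : E) (n : ℕ) :
    g ((lazyEpoch g M m)^[n] zs) - g w ≤ (1 - 1 / 2401) ^ n * (g zs - g w) := by
  induction n with
  | zero => simp
  | succ n ih =>
    rw [Function.iterate_succ_apply']
    refine (hg.sub_min_lazyEpoch_le hγ hm hΛ hM hγB hBγ hw _).trans ?_
    rw [pow_succ']
    linarith

end CubicallyConvex

/-- The number of epochs suffices for polynomial accuracy in `m`. -/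
theorem contraction_pow_le {m K : ℕ} (hm : 1 ≤ m)
    (hK : 100000 * (m * (1 + Real.log m)) ≤ (K : ℝ)) :
    (1 - 1 / 2401 : ℝ) ^ ⌈(K : ℝ) / (m : ℝ)⌉₊ ≤ 1 / (10 ^ 12 * (m : ℝ) ^ 4) := by
  have hm1 : (1 : ℝ) ≤ m := by exact_mod_cast hm
  have hm0 : (0 : ℝ) < m := by linarith
  have hlog : 0 ≤ Real.log m := Real.log_nonneg hm1
  set N := ⌈(K : ℝ) / (m : ℝ)⌉₊
  have hN : 100000 * (1 + Real.log m) ≤ (N : ℝ) := by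
    refine le_trans ?_ (Nat.le_ceil _)
    rw [le_div_iff₀ hm0]
    linarith
  have h1 : (1 - 1 / 2401 : ℝ) ≤ Real.exp (-(1 / 2401)) := by
    have := Real.add_one_le_exp (-(1 / 2401) : ℝ); linarith
  -- `100000 / 2401` exceeds `40`, enough for both the constant and the power of `m`.
  have h2 : (1 - 1 / 2401 : ℝ) ^ N ≤ Real.exp (-(40 + 4 * Real.log m)) := by
    calc _ ≤ Real.exp (-(1 / 2401)) ^ N := by gcongr
      _ = Real.exp (N * (-(1 / 2401))) := by rw [← Real.exp_nat_mul]
      _ ≤ _ := by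
        apply Real.exp_le_exp.2
        linarith
  refine h2.trans ?_
  rw [Real.exp_neg, ← one_div]
  have h3 : Real.exp (40 + 4 * Real.log m) = Real.exp 40 * (m : ℝ) ^ 4 := by
    rw [Real.exp_add]
    congr 1
    rw [show (4 : ℝ) * Real.log m = ((4 : ℕ) : ℝ) * Real.log m by norm_num, Real.exp_nat_mul,
      Real.exp_log hm0]
  rw [h3]
  have h4 : (10 : ℝ) ^ 12 ≤ Real.exp 40 := by
    have h5 : (2 : ℝ) ≤ Real.exp 1 := by have := Real.add_one_le_exp (1 : ℝ); linarith
    have h6 : Real.exp 40 = Real.exp 1 ^ 40 := by rw [← Real.exp_nat_mul]; norm_num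
    rw [h6]
    calc (10 : ℝ) ^ 12 ≤ 2 ^ 40 := by norm_num
      _ ≤ _ := by gcongr
  gcongr

/-- The MS-solver satisfies the Monteiro–Svaiter condition. -/
theorem norm_gradient_proxFun_msSolver_le {f : E → ℝ} {L : ℝ} {K : ℕ} (hL : 0 < L) (hm : 1 ≤ m)
    (hf : HasLipschitzHessian L f) (hc : ConvexOn ℝ Set.univ f) (hγ : γ = L / m)
    (hM : M = 6 * m * (L + 2 * γ)) (hK : 100000 * (m * (1 + Real.log m)) ≤ (K : ℝ)) (zbar : E) :
    ‖gradient (proxFun f γ zbar) (msSolver f L K M m γ zbar)‖ ≤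
      1 / 2 * γ * ‖msSolver f L K M m γ zbar - zbar‖ ^ 2 := by
  have hm1 : (1 : ℝ) ≤ m := by exact_mod_cast hm
  have hm0 : (0 : ℝ) < m := by linarith
  have hγ0 : 0 < γ := by rw [hγ]; positivity
  have hLγ : L = m * γ := by rw [hγ]; field_simp
  have hγL : γ ≤ L := by rw [hLγ]; nlinarith
  have hg := cubicallyConvex_proxFun hL.le hγ0.le hf hc zbar
  have hΛ : L + 4 * γ ≤ 5 * L := by linarith
  obtain ⟨w, hw⟩ := hg.exists_minimizer hγ0
  rw [msSolver]
  set g := proxFun f γ zbar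
  set z0 := crnStep L (gradient g) zbar (hess g zbar) with hz0
  set zN := (lazyEpoch g M m)^[⌈(K : ℝ) / (m : ℝ)⌉₊] z0 with hzN
  have h1 := hg.norm_crnStep_sub_le hL hΛ hw zbar
  have h2 := hg.norm_gradient_crnStep_le hL hΛ zbar
  have h3 := hg.norm_crnStep_sub_le hL hΛ hw zN
  have h4 := hg.norm_gradient_crnStep_le hL hΛ zN
  rw [← hz0] at h1 h2
  set y := crnStep L (gradient g) zN (hess g zN) with hy
  set D := ‖zbar - w‖ with hD
  have hD0 : 0 ≤ D := norm_nonneg _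
  have hgap0 : g z0 - g w ≤ 5000 * L * D ^ 3 := by
    have e1 : ‖z0 - zbar‖ ≤ 10 * D := by
      have := norm_sub_le (z0 - w) (zbar - w)
      rw [sub_sub_sub_cancel_right] at this
      linarith
    calc g z0 - g w ≤ ⟪gradient g z0, z0 - w⟫_ℝ := hg.sub_le_inner hγ0.le w z0
      _ ≤ ‖gradient g z0‖ * ‖z0 - w‖ := real_inner_le_norm _ _
      _ ≤ (11 / 2 * L * (10 * D) ^ 2) * (9 * D) := by
          gcongr
          exact h2.trans (by gcongr)
      _ = 4950 * L * D ^ 3 := by ring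
      _ ≤ _ := by gcongr; norm_num
  have hgapN : g zN - g w ≤ 1 / (10 ^ 12 * (m : ℝ) ^ 4) * (5000 * L * D ^ 3) := by
    refine (hg.sub_min_iterate_lazyEpoch_le (B := L + 2 * γ) hγ0 hm (by linarith) hM
      (by linarith) (by linarith) hw z0 _).trans ?_
    have := contraction_pow_le hm hK
    have hnn : 0 ≤ g z0 - g w := sub_nonneg.2 (hw _)
    gcongr
  -- Of the factor `m ^ 4` gained by the epochs, one power pays for `L = m * γ` and three give the
  -- `1 / m` in the distance.
  have hdist : ‖zN - w‖ ≤ D / (100 * m) := by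
    have e1 := hg.cube_le_sub_min hw zN
    have e2 : γ / 12 * ‖zN - w‖ ^ 3 ≤ γ / 12 * (D / (100 * m)) ^ 3 := by
      refine (e1.trans hgapN).trans ?_
      rw [hLγ, div_pow]
      have : 0 ≤ γ * D ^ 3 / m ^ 3 := by positivity
      have e3 : 1 / (10 ^ 12 * (m : ℝ) ^ 4) * (5000 * (m * γ) * D ^ 3) =
          5000 / 10 ^ 12 * (γ * D ^ 3 / m ^ 3) := by field_simp
      have e4 : γ / 12 * (D ^ 3 / (100 * (m : ℝ)) ^ 3) =
          1 / (12 * 10 ^ 6) * (γ * D ^ 3 / m ^ 3) := by field_simp; norm_num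
      rw [e3, e4]
      exact mul_le_mul_of_nonneg_right (by norm_num) this
    exact le_of_pow_le_pow_left₀ three_ne_zero (by positivity)
      (le_of_mul_le_mul_left e2 (by positivity))
  have hη : D / (100 * m) ≤ D / 100 := by
    gcongr; linarith
  have e1 : ‖y - zN‖ ≤ 10 * (D / (100 * m)) := by
    have := norm_sub_le (y - w) (zN - w)
    rw [sub_sub_sub_cancel_right] at this
    linarith
  -- As `y` is much closer to `w` than `zbar` is, the length of the move controls `D`; this makes
  -- the gradient bound relative to the move.
  have e2 : D / 2 ≤ ‖y - zbar‖ := by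
    have := norm_sub_le (y - w) (y - zbar)
    rw [sub_sub_sub_cancel_left, ← hD] at this
    linarith
  calc ‖gradient g y‖ ≤ 11 / 2 * L * (10 * (D / (100 * m))) ^ 2 := h4.trans (by gcongr)
    _ = 11 / 200 * γ * D ^ 2 / m := by rw [hLγ]; field_simp; ring
    _ ≤ 11 / 200 * γ * D ^ 2 := div_le_self (by positivity) hm1
    _ ≤ 1 / 2 * γ * (D / 2) ^ 2 := by nlinarith [mul_nonneg hγ0.le (sq_nonneg D)]
    _ ≤ _ := by gcongr

end Epoch

/-! ### Amortized count of the bisection steps. -/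

section Growth

/-- A step with large weight gain raises `b ^ 2` by a fixed amount or `log b` by a constant. -/
theorem growth_of_cube_add_le {b b' ℓ θ : ℝ} (hb : 0 < b) (hb' : 0 < b') (hℓ : 0 < ℓ) (hθ : 0 < θ)
    (hlow : ℓ * b ^ 2 ≤ 2 * θ ^ 2) (h : b ^ 3 + 1 / (2 * √ℓ) ≤ b' ^ 3) :
    2 * Real.log 2 ≤ 18 * Real.log 2 * (θ * (b' ^ 2 - b ^ 2)) + 3 * (Real.log b' - Real.log b) := by
  have hs : 0 < √ℓ := Real.sqrt_pos.2 hℓ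
  have hs2 : √ℓ ^ 2 = ℓ := Real.sq_sqrt hℓ.le
  have hlog2 : 0 < Real.log 2 := Real.log_pos (by norm_num)
  have hbb : b ≤ b' := by
    refine le_of_pow_le_pow_left₀ three_ne_zero hb'.le (le_trans ?_ h)
    have : 0 < 1 / (2 * √ℓ) := by positivity
    linarith
  have hlogm : Real.log b ≤ Real.log b' := Real.log_le_log hb hbb
  have hsb : 2 * √ℓ * b ≤ 3 * θ := by
    refine le_of_sq_le_sq ?_ (by positivity)
    have : (2 * √ℓ * b) ^ 2 = 4 * (ℓ * b ^ 2) := by rw [mul_pow, mul_pow, hs2]; ring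
    nlinarith [sq_nonneg θ]
  have hinc : b / (3 * θ) ≤ 1 / (2 * √ℓ) := by
    rw [div_le_div_iff₀ (by positivity) (by positivity)]
    linarith
  set c := 1 / (9 * θ) with hc
  have hc0 : 0 < c := by positivity
  have hcb : b / (3 * θ) = 3 * c * b := by rw [hc]; field_simp; norm_num
  have h3 : b * (b ^ 2 + 3 * c) ≤ b' ^ 3 := by
    rw [hcb] at hinc
    nlinarith
  -- For `b ^ 2 ≥ c` the square gains at least `c = 1 / (9 * θ)`; for smaller `b` the cube at least
  -- quadruples. Either gain alone pays `2 * Real.log 2`.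
  rcases le_total c (b ^ 2) with h4 | h4
  · have h5 : b ^ 2 + c ≤ b' ^ 2 := by
      refine le_of_pow_le_pow_left₀ three_ne_zero (by positivity) ?_
      calc (b ^ 2 + c) ^ 3 ≤ (b * (b ^ 2 + 3 * c)) ^ 2 := by
            nlinarith [mul_nonneg hc0.le (mul_self_nonneg (b ^ 2)),
              mul_le_mul h4 h4 hc0.le (sq_nonneg b), mul_nonneg hc0.le (sq_nonneg (b * c)),
              mul_le_mul_of_nonneg_left (mul_le_mul h4 h4 hc0.le (sq_nonneg b)) hc0.le,
              mul_nonneg (sq_nonneg b) (sq_nonneg c)]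
        _ ≤ (b' ^ 3) ^ 2 := by gcongr
        _ = (b' ^ 2) ^ 3 := by ring
    have h6 : 1 / 9 ≤ θ * (b' ^ 2 - b ^ 2) := by
      have : θ * c = 1 / 9 := by rw [hc]; field_simp
      nlinarith
    nlinarith
  · have h5 : 4 * b ^ 3 ≤ b' ^ 3 := by nlinarith
    have h6 := Real.log_le_log (by positivity) h5
    rw [Real.log_mul (by norm_num) (by positivity), Real.log_pow, Real.log_pow,
      show (4 : ℝ) = 2 ^ 2 by norm_num, Real.log_pow] at h6
    push_cast at h6
    have h7 : 0 ≤ θ * (b' ^ 2 - b ^ 2) := by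
      have : b ^ 2 ≤ b' ^ 2 := by gcongr
      exact mul_nonneg hθ.le (by linarith)
    have h8 := mul_nonneg hlog2.le h7
    linarith

/-- The bisection dynamics of adaptive Monteiro–Svaiter acceleration: the number of iterations is
at most a constant multiple of `b ^ (12 / 7)`. -/
theorem iterations_le_of_growth {b ℓ X : ℕ → ℝ} {T : ℕ} (hT : 1 ≤ T) (hb : ∀ t, 0 ≤ b t)
    (hb1 : 1 ≤ b 1) (hℓ : ∀ t, 0 < ℓ t) (hinit : ℓ 1 * b 1 ^ 6 = 1 / 2)
    (hX1 : 0 ≤ X 1) (hXT : X T ≤ 1)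
    (hstep : ∀ t, 1 ≤ t →
      (b t ^ 3 + 1 / (2 * √(ℓ t)) ≤ b (t + 1) ^ 3 ∧ ℓ (t + 1) = ℓ t / 2 ∧ X t ≤ X (t + 1)) ∨
      (b t ≤ b (t + 1) ∧ ℓ (t + 1) = 2 * ℓ t ∧ X t + b t ^ 6 * ℓ t ^ 3 ≤ X (t + 1))) :
    (T : ℝ) ≤ 56 * b T ^ (12 / 7 : ℝ) := by
  have hmono : ∀ t, 1 ≤ t → b t ≤ b (t + 1) := by
    intro t ht
    rcases hstep t ht with h | h
    · refine le_of_pow_le_pow_left₀ three_ne_zero (hb _) (le_trans ?_ h.1)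
      have : 0 < 1 / (2 * √(ℓ t)) := by have := Real.sqrt_pos.2 (hℓ t); positivity
      linarith
    · exact h.1
  have hge : ∀ t, 1 ≤ t → b 1 ≤ b t := by
    intro t ht
    induction t, ht using Nat.le_induction with
    | base => exact le_rfl
    | succ t ht ih => exact ih.trans (hmono t ht)
  have hpos : ∀ t, 1 ≤ t → 0 < b t := fun t ht => by linarith [hge t ht]
  have hlog2 : 0 < Real.log 2 := Real.log_pos (by norm_num)
  have hbT : 1 ≤ b T := hb1.trans (hge T hT)
  -- This exponent balances the two budgets: `θ * b T ^ 2` and `1 / θ ^ 6` both equal `b T ^ (12 /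
  -- 7)`.
  set θ : ℝ := b T ^ (-(2 / 7) : ℝ) with hθdef
  have hθ : 0 < θ := Real.rpow_pos_of_pos (by linarith) _
  set ψ : ℕ → ℝ := fun t => Real.log (ℓ t) + 2 * Real.log (b t) - 2 * Real.log θ with hψ
  have hψlog : ∀ t, 1 ≤ t → ψ t = Real.log (ℓ t * b t ^ 2 / θ ^ 2) := by
    intro t ht
    have h1 := hpos t ht
    have h2 := hℓ t
    rw [Real.log_div (by positivity) (by positivity), Real.log_mul (by positivity) (by positivity),
      Real.log_pow, Real.log_pow]
    push_cast
    rfl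
  -- `ψ` measures the logarithmic distance of `ℓ * b ^ 2` from `θ ^ 2`. A step towards this level
  -- pays for itself by reducing `|ψ|`. A step away costs `2 * Real.log 2`, charged to the growth of
  -- `b` when halving and to `X` when doubling. Of the coefficient `5` of `log b`, `3` comes from
  -- growth and `2` from the drift of `ψ`.
  have key : ∀ t, 1 ≤ t → Real.log 2 * t + |ψ t| ≤ Real.log 2 + |ψ 1| +
      18 * Real.log 2 * (θ * b t ^ 2) + 5 * Real.log (b t) +
      16 * Real.log 2 * (X t / θ ^ 6) := by
    intro t ht
    induction t, ht using Nat.le_induction with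
    | base =>
      have h1 : 0 ≤ Real.log (b 1) := Real.log_nonneg hb1
      have h2 : 0 ≤ 18 * Real.log 2 * (θ * b 1 ^ 2) := by positivity
      have h3 : 0 ≤ 16 * Real.log 2 * (X 1 / θ ^ 6) := by positivity
      push_cast
      linarith
    | succ t ht ih =>
      have hbt := hpos t ht
      have hbt' := hpos (t + 1) (by omega)
      have hΔ : Real.log (b t) ≤ Real.log (b (t + 1)) := Real.log_le_log hbt (hmono t ht)
      have hsq : b t ^ 2 ≤ b (t + 1) ^ 2 := by gcongr; exact hmono t ht
      have hsq' : 0 ≤ 18 * Real.log 2 * (θ * (b (t + 1) ^ 2 - b t ^ 2)) :=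
        mul_nonneg (by positivity) (mul_nonneg hθ.le (by linarith))
      have hexp := hψlog t ht
      push_cast
      rcases hstep t ht with ⟨h1, h2, h3⟩ | ⟨h1, h2, h3⟩
      · have hψ' : ψ (t + 1) = ψ t - Real.log 2 +
            2 * (Real.log (b (t + 1)) - Real.log (b t)) := by
          simp only [hψ, h2]
          rw [Real.log_div (hℓ t).ne' (by norm_num)]
          ring
        have hX : 0 ≤ 16 * Real.log 2 * ((X (t + 1) - X t) / θ ^ 6) :=
          mul_nonneg (by positivity) (div_nonneg (by linarith) (by positivity))
        rw [sub_div] at hX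
        rcases le_total (ψ t) (Real.log 2) with hc | hc
        · have hlow : ℓ t * b t ^ 2 ≤ 2 * θ ^ 2 := by
            rw [hexp, Real.log_le_log_iff (by have := hℓ t; positivity) (by norm_num),
              div_le_iff₀ (by positivity)] at hc
            exact hc
          have hgrow := growth_of_cube_add_le hbt hbt' (hℓ t) hθ hlow h1
          have habs : |ψ (t + 1)| ≤ |ψ t| + Real.log 2 +
              2 * (Real.log (b (t + 1)) - Real.log (b t)) := by
            rw [hψ', abs_le]
            constructor <;> linarith [neg_abs_le (ψ t), le_abs_self (ψ t)]
          linarith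
        · have habs : |ψ (t + 1)| ≤ |ψ t| - Real.log 2 +
              2 * (Real.log (b (t + 1)) - Real.log (b t)) := by
            rw [hψ', abs_le]
            constructor <;> linarith [neg_abs_le (ψ t), le_abs_self (ψ t)]
          linarith
      · have hψ' : ψ (t + 1) = ψ t + Real.log 2 +
            2 * (Real.log (b (t + 1)) - Real.log (b t)) := by
          simp only [hψ, h2]
          rw [Real.log_mul (by norm_num) (hℓ t).ne']
          ring
        have hℓt := hℓ t
        rcases le_total (-Real.log 2) (ψ t) with hc | hc
        · have hhigh : θ ^ 2 / 2 ≤ ℓ t * b t ^ 2 := by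
            rw [hexp, ← Real.log_inv, Real.log_le_log_iff (by norm_num) (by positivity),
              le_div_iff₀ (by positivity)] at hc
            linarith
          have hcube : θ ^ 6 / 8 ≤ b t ^ 6 * ℓ t ^ 3 := by
            calc θ ^ 6 / 8 = (θ ^ 2 / 2) ^ 3 := by ring
              _ ≤ (ℓ t * b t ^ 2) ^ 3 := by gcongr
              _ = _ := by ring
          have hX : 2 * Real.log 2 ≤ 16 * Real.log 2 * ((X (t + 1) - X t) / θ ^ 6) := by
            have : 1 / 8 ≤ (X (t + 1) - X t) / θ ^ 6 := by
              rw [le_div_iff₀ (by positivity)]; linarith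
            nlinarith
          rw [sub_div] at hX
          have habs : |ψ (t + 1)| ≤ |ψ t| + Real.log 2 +
              2 * (Real.log (b (t + 1)) - Real.log (b t)) := by
            rw [hψ', abs_le]
            constructor <;> linarith [neg_abs_le (ψ t), le_abs_self (ψ t)]
          linarith
        · have hX : 0 ≤ 16 * Real.log 2 * ((X (t + 1) - X t) / θ ^ 6) := by
            have : 0 ≤ b t ^ 6 * ℓ t ^ 3 := by positivity
            exact mul_nonneg (by positivity) (div_nonneg (by linarith) (by positivity))
          rw [sub_div] at hX
          have habs : |ψ (t + 1)| ≤ |ψ t| - Real.log 2 +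
              2 * (Real.log (b (t + 1)) - Real.log (b t)) := by
            rw [hψ', abs_le]
            constructor <;> linarith [neg_abs_le (ψ t), abs_of_nonpos (show ψ t ≤ 0 by linarith)]
          linarith
  have hfin := key T hT
  have hbT0 : 0 < b T := by linarith
  have hlogT : 0 ≤ Real.log (b T) := Real.log_nonneg hbT
  have hlog1 : 0 ≤ Real.log (b 1) := Real.log_nonneg hb1
  have hlog1T : Real.log (b 1) ≤ Real.log (b T) := Real.log_le_log (by linarith) (hge T hT)
  have hlogθ : Real.log θ = -(2 / 7) * Real.log (b T) := Real.log_rpow hbT0 _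
  have hψ1 : |ψ 1| ≤ Real.log 2 + 5 * Real.log (b T) := by
    have h1 : Real.log (ℓ 1) + 6 * Real.log (b 1) = -Real.log 2 := by
      have h := congrArg Real.log hinit
      have := hℓ 1
      rw [Real.log_mul (by positivity) (by positivity), Real.log_pow, one_div, Real.log_inv] at h
      exact_mod_cast h
    simp only [hψ]
    rw [hlogθ, abs_le]
    constructor <;> linarith
  have hθb : θ * b T ^ 2 = b T ^ (12 / 7 : ℝ) := by
    rw [hθdef, ← Real.rpow_natCast, ← Real.rpow_add hbT0]
    norm_num
  have hθX : X T / θ ^ 6 ≤ b T ^ (12 / 7 : ℝ) := by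
    have h1 : b T ^ (12 / 7 : ℝ) = 1 / θ ^ 6 := by
      rw [hθdef, ← Real.rpow_natCast, ← Real.rpow_mul hbT0.le, one_div, ← Real.rpow_neg hbT0.le]
      norm_num
    rw [h1]
    gcongr
  have hge1 : 1 ≤ b T ^ (12 / 7 : ℝ) := Real.one_le_rpow hbT (by norm_num)
  have hlogle : Real.log (b T) ≤ b T ^ (12 / 7 : ℝ) := by
    have h1 := Real.log_le_sub_one_of_pos hbT0
    have h2 : b T ^ (1 : ℝ) ≤ b T ^ (12 / 7 : ℝ) :=
      Real.rpow_le_rpow_of_exponent_le hbT (by norm_num)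
    rw [Real.rpow_one] at h2
    linarith
  set Y := b T ^ (12 / 7 : ℝ)
  rw [hθb] at hfin
  have hhalf : 1 / 2 ≤ Real.log 2 := by linarith [Real.log_two_gt_d9]
  have h16 : 16 * Real.log 2 * (X T / θ ^ 6) ≤ 16 * Real.log 2 * Y := by gcongr
  have h0 := abs_nonneg (ψ T)
  have h10 : 10 * Real.log (b T) ≤ 20 * Real.log 2 * Y := by nlinarith
  -- `56 = 2 + 18 + 20 + 16`, in units of `Real.log 2 * Y`.
  have : Real.log 2 * T ≤ Real.log 2 * (56 * Y) := by nlinarith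
  exact le_of_mul_le_mul_left this hlog2

end Growth

/-! ### The potential and the Monteiro–Svaiter inequality. -/

section Potential

variable {E : Type*} [NormedAddCommGroup E]

/-- The potential of Monteiro–Svaiter acceleration. -/
noncomputable def msPotential (f : E → ℝ) (zstar : E) (A : ℝ) (z v : E) : ℝ :=
  A * (f z - f zstar) + 1 / 2 * ‖v - zstar‖ ^ 2

theorem msPotential_nonneg {f : E → ℝ} {zstar : E} (hmin : ∀ z, f zstar ≤ f z) {A : ℝ} (hA : 0 ≤ A) (z v : E) :
    0 ≤ msPotential f zstar A z v := by
  have := sub_nonneg.2 (hmin z)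
  unfold msPotential
  positivity

/-- Consequence of the Monteiro–Svaiter condition. -/
theorem ms_inner_ge [InnerProductSpace ℝ E] {p y zbar : E} {lam : ℝ}
    (h : ‖p + lam • (y - zbar)‖ ≤ 1 / 2 * (lam * ‖y - zbar‖)) :
    ‖p‖ ^ 2 + 3 / 4 * lam ^ 2 * ‖y - zbar‖ ^ 2 ≤ 2 * lam * ⟪p, zbar - y⟫_ℝ := by
  have h1 : ‖p + lam • (y - zbar)‖ ^ 2 ≤ (1 / 2 * (lam * ‖y - zbar‖)) ^ 2 := by gcongr
  rw [norm_add_sq_real, norm_smul, real_inner_smul_right, mul_pow, Real.norm_eq_abs, sq_abs] at h1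
  rw [← neg_sub y zbar, inner_neg_right]
  nlinarith

end Potential

/-! ### Potential decrease and convergence rate of A-LEN. -/

section Acceleration

variable {E : Type*} [NormedAddCommGroup E] [InnerProductSpace ℝ E] [CompleteSpace E]
  {f : E → ℝ} {zstar : E}

/-- The linear coupling inequality. -/
theorem coupling_le (hc : ConvexOn ℝ Set.univ f) (hd : Differentiable ℝ f) {A a : ℝ}
    (hA : 0 ≤ A) (ha : 0 < a) (z v y zbar : E)
    (hzbar : zbar = (A / (A + a)) • z + (a / (A + a)) • v) :
    (A + a) * ⟪gradient f y, zbar - y⟫_ℝ + (A + a) * (f y - f zstar) - A * (f z - f zstar) ≤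
      a * ⟪gradient f y, v - zstar⟫_ℝ := by
  have hne : A + a ≠ 0 := by positivity
  have h1 := convexOn_add_inner_gradient_le hc hd y z
  have h2 := convexOn_add_inner_gradient_le hc hd y zstar
  have h3 : a • (v - zstar) = (A + a) • (zbar - y) - A • (z - y) - a • (zstar - y) := by
    have : (A + a) • zbar = A • z + a • v := by
      rw [hzbar, smul_add, smul_smul, smul_smul, mul_div_cancel₀ _ hne, mul_div_cancel₀ _ hne]
    rw [smul_sub (A + a), this]
    module
  have h4 : a * ⟪gradient f y, v - zstar⟫_ℝ = (A + a) * ⟪gradient f y, zbar - y⟫_ℝ -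
      A * ⟪gradient f y, z - y⟫_ℝ - a * ⟪gradient f y, zstar - y⟫_ℝ := by
    rw [← real_inner_smul_right, h3]
    simp only [inner_sub_right, real_inner_smul_right]
  rw [h4]
  nlinarith

/-- A step whose regularization does not exceed the guess. -/
theorem msPotential_down (hc : ConvexOn ℝ Set.univ f) (hd : Differentiable ℝ f) {A a lam lam' : ℝ}
    (hA : 0 ≤ A) (ha : 0 < a) (hlam : 0 ≤ lam) (hle : lam ≤ lam')
    (haA : lam' * a ^ 2 = A + a) (z v y zbar : E)
    (hzbar : zbar = (A / (A + a)) • z + (a / (A + a)) • v)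
    (h : ‖gradient f y + lam • (y - zbar)‖ ≤ 1 / 2 * (lam * ‖y - zbar‖)) :
    msPotential f zstar (A + a) y (v - a • gradient f y) +
      3 / 8 * (A + a) * lam * ‖y - zbar‖ ^ 2 ≤ msPotential f zstar A z v := by
  have h1 := coupling_le (zstar := zstar) hc hd hA ha z v y zbar hzbar
  have h2 := ms_inner_ge h
  have hv : ‖v - a • gradient f y - zstar‖ ^ 2 = ‖v - zstar‖ ^ 2 -
      2 * (a * ⟪gradient f y, v - zstar⟫_ℝ) + a ^ 2 * ‖gradient f y‖ ^ 2 := by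
    rw [sub_right_comm, norm_sub_sq_real, real_inner_smul_right, norm_smul, mul_pow,
      Real.norm_eq_abs, sq_abs, real_inner_comm]
  have h3 : a ^ 2 * ‖gradient f y‖ ^ 2 + 3 / 4 * (A + a) * lam * ‖y - zbar‖ ^ 2 ≤
      2 * ((A + a) * ⟪gradient f y, zbar - y⟫_ℝ) := by
    -- The bound is proved after multiplication by `lam`; for `lam = 0` the Monteiro–Svaiter
    -- condition forces the gradient to vanish.
    rcases hlam.eq_or_lt with h0 | h0
    · subst h0
      have hp : gradient f y = 0 := by simpa using h
      simp [hp]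
    · have h4 : (lam * a ^ 2) * ‖gradient f y‖ ^ 2 ≤ (A + a) * ‖gradient f y‖ ^ 2 := by
        rw [← haA]; gcongr
      have h5 := mul_le_mul_of_nonneg_left h2 (add_nonneg hA ha.le)
      refine le_of_mul_le_mul_left ?_ h0
      nlinarith
  unfold msPotential
  rw [hv]
  linarith

/-- A step whose regularization exceeds the guess. -/
theorem msPotential_up (hc : ConvexOn ℝ Set.univ f) (hd : Differentiable ℝ f) {A a lam lam' : ℝ}
    (hA : 0 ≤ A) (ha : 0 < a) (hlam' : 0 < lam') (hlt : lam' < lam)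
    (haA : lam' * a ^ 2 = A + a) (z v y zbar : E)
    (hzbar : zbar = (A / (A + a)) • z + (a / (A + a)) • v)
    (h : ‖gradient f y + lam • (y - zbar)‖ ≤ 1 / 2 * (lam * ‖y - zbar‖)) :
    msPotential f zstar (A + lam' / lam * a)
        (((1 - lam' / lam) * A / (A + lam' / lam * a)) • z +
          (lam' / lam * (A + a) / (A + lam' / lam * a)) • y)
        (v - (lam' / lam * a) • gradient f y) +
      3 / 8 * (A + a) * lam' * ‖y - zbar‖ ^ 2 ≤ msPotential f zstar A z v := by
  have hlam : 0 < lam := hlam'.trans hlt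
  obtain ⟨ρ, hρ⟩ : ∃ ρ, ρ = lam' / lam := ⟨_, rfl⟩
  have hρ0 : 0 < ρ := by rw [hρ]; positivity
  have hρ1 : ρ < 1 := by rw [hρ, div_lt_one hlam]; exact hlt
  have hlam'' : lam' = ρ * lam := by rw [hρ]; field_simp
  rw [← hρ]
  have hA' : 0 < A + ρ * a := by positivity
  have h1 := coupling_le (zstar := zstar) hc hd hA ha z v y zbar hzbar
  have h2 := ms_inner_ge h
  have hv : ‖v - (ρ * a) • gradient f y - zstar‖ ^ 2 = ‖v - zstar‖ ^ 2 -
      2 * (ρ * (a * ⟪gradient f y, v - zstar⟫_ℝ)) + (ρ * a) ^ 2 * ‖gradient f y‖ ^ 2 := by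
    rw [sub_right_comm, norm_sub_sq_real, real_inner_smul_right, norm_smul, mul_pow,
      Real.norm_eq_abs, sq_abs, real_inner_comm]
    ring
  have hconv := hc.2 (Set.mem_univ z) (Set.mem_univ y)
    (show 0 ≤ (1 - ρ) * A / (A + ρ * a) from
      div_nonneg (mul_nonneg (by linarith) hA) hA'.le)
    (show 0 ≤ ρ * (A + a) / (A + ρ * a) by positivity) (by field_simp; ring)
  set x := ((1 - ρ) * A / (A + ρ * a)) • z + (ρ * (A + a) / (A + ρ * a)) • y
  have hx : (A + ρ * a) * (f x - f zstar) ≤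
      (1 - ρ) * A * (f z - f zstar) + ρ * (A + a) * (f y - f zstar) := by
    have := mul_le_mul_of_nonneg_left hconv hA'.le
    simp only [smul_eq_mul] at this
    have he : (A + ρ * a) * ((1 - ρ) * A / (A + ρ * a) * f z + ρ * (A + a) / (A + ρ * a) * f y) =
        (1 - ρ) * A * f z + ρ * (A + a) * f y := by field_simp
    rw [he] at this
    nlinarith
  -- Damping the weight by `ρ` restores the balance: `lam * ρ * a ^ 2 = lam' * a ^ 2 = A + a`, so
  -- the gradient term is absorbed although the guess was too small.
  have h3 : ρ * a ^ 2 * ‖gradient f y‖ ^ 2 + 3 / 4 * (A + a) * lam * ‖y - zbar‖ ^ 2 ≤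
      2 * ((A + a) * ⟪gradient f y, zbar - y⟫_ℝ) := by
    have h5 := mul_le_mul_of_nonneg_left h2 (add_nonneg hA ha.le)
    refine le_of_mul_le_mul_left ?_ hlam
    have h6 : lam * (ρ * a ^ 2 * ‖gradient f y‖ ^ 2) = (A + a) * ‖gradient f y‖ ^ 2 := by
      rw [← haA, hlam'']; ring
    nlinarith
  have h4 := mul_le_mul_of_nonneg_left h1 hρ0.le
  have h5 := mul_le_mul_of_nonneg_left h3 hρ0.le
  unfold msPotential
  rw [hv, hlam'']
  nlinarith

/-- The weight `a` solves `lam * a ^ 2 = A + a`. -/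
theorem weight_spec {A lam : ℝ} (hA : 0 ≤ A) (hlam : 0 < lam) :
    0 < 1 / (2 * lam) * (1 + √(1 + 4 * lam * A)) ∧
    lam * (1 / (2 * lam) * (1 + √(1 + 4 * lam * A))) ^ 2 =
      A + 1 / (2 * lam) * (1 + √(1 + 4 * lam * A)) ∧
    √A + 1 / (2 * √lam) ≤ √(A + 1 / (2 * lam) * (1 + √(1 + 4 * lam * A))) := by
  have h1 : 0 ≤ 1 + 4 * lam * A := by positivity
  have hs := Real.sq_sqrt h1
  have hl := Real.sq_sqrt hlam.le
  have hl0 := Real.sqrt_pos.2 hlam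
  have hspec : lam * (1 / (2 * lam) * (1 + √(1 + 4 * lam * A))) ^ 2 =
      A + 1 / (2 * lam) * (1 + √(1 + 4 * lam * A)) := by
    generalize √(1 + 4 * lam * A) = s at hs
    field_simp
    linarith
  refine ⟨by positivity, hspec, ?_⟩
  apply Real.le_sqrt_of_sq_le
  rw [← hspec]
  have h2 : 2 * √lam * √A ≤ √(1 + 4 * lam * A) := by
    apply Real.le_sqrt_of_sq_le
    rw [mul_pow, mul_pow, hl, Real.sq_sqrt hA]
    linarith
  have h3 : √A + 1 / (2 * √lam) ≤ √lam * (1 / (2 * lam) * (1 + √(1 + 4 * lam * A))) := by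
    have h4 : √lam * (1 / (2 * lam) * (1 + √(1 + 4 * lam * A))) =
        (1 + √(1 + 4 * lam * A)) / (2 * √lam) := by
      nth_rewrite 2 [← hl]
      field_simp
    have h5 : √A + 1 / (2 * √lam) = (1 + 2 * √lam * √A) / (2 * √lam) := by
      field_simp
      ring
    rw [h4, h5]
    gcongr
  calc (√A + 1 / (2 * √lam)) ^ 2
      ≤ (√lam * (1 / (2 * lam) * (1 + √(1 + 4 * lam * A)))) ^ 2 := by gcongr
    _ = _ := by rw [mul_pow, hl]

variable {L M γ : ℝ} {K m : ℕ} {z₀ z1 : E}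

/-- The potential along A-LEN. -/
noncomputable def alenPotential (f : E → ℝ) (zstar : E) (st : ALenState E) : ℝ :=
  msPotential f zstar st.A st.z st.v

theorem alenIter_one (hγ : 0 < γ) (hc : ConvexOn ℝ Set.univ f) (hd : Differentiable ℝ f)
    (hne : z1 ≠ z₀)
    (hMS : ‖gradient f z1 + (γ * ‖z1 - z₀‖) • (z1 - z₀)‖ ≤
      1 / 2 * (γ * ‖z1 - z₀‖ * ‖z1 - z₀‖)) :
    (alenIter f L 2 K M m γ z₀ z1 1).lam = γ * ‖z1 - z₀‖ / 2 ∧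
    (alenIter f L 2 K M m γ z₀ z1 1).A = 1 / (γ * ‖z1 - z₀‖) ∧
    alenPotential f zstar (alenIter f L 2 K M m γ z₀ z1 1) + 3 / 8 * ‖z1 - z₀‖ ^ 2 ≤
      1 / 2 * ‖z₀ - zstar‖ ^ 2 := by
  have hn : 0 < ‖z1 - z₀‖ := norm_sub_pos_iff.2 hne
  set lam := γ * ‖z1 - z₀‖ with hlam
  have hlam0 : 0 < lam := by positivity
  have ha : 1 / (2 * lam) * (1 + √(1 + 4 * lam * 0)) = 1 / lam := by
    rw [mul_zero, add_zero, Real.sqrt_one]; field_simp; norm_num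
  have hst : alenIter f L 2 K M m γ z₀ z1 1 =
      ⟨z1, z₀ - (1 / lam) • gradient f z1, 0 + 1 / lam, 1 / 2 * lam, msSolverSteps K m⟩ := by
    simp only [alenIter, if_true, le_refl, ← hlam, ha]
  have h := msPotential_down (zstar := zstar) hc hd le_rfl (one_div_pos.2 hlam0) hlam0.le
    le_rfl (by field_simp; ring) z₀ z₀ z1 z₀ (by
      rw [zero_div, zero_smul, zero_add, zero_add, div_self (one_div_pos.2 hlam0).ne', one_smul])
      hMS
  rw [hst]
  refine ⟨by ring, by ring, ?_⟩
  have h2 : 3 / 8 * (0 + 1 / lam) * lam * ‖z1 - z₀‖ ^ 2 = 3 / 8 * ‖z1 - z₀‖ ^ 2 := by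
    field_simp; norm_num
  rw [h2] at h
  refine h.trans (le_of_eq ?_)
  simp [msPotential]

/-- One iteration of A-LEN after the first: either the guess is halved and `√A` grows, or the guess
is doubled and the potential drops. -/
theorem alenIter_succ_step (hγ : 0 < γ) (hc : ConvexOn ℝ Set.univ f) (hd : Differentiable ℝ f)
    (hMS : ∀ zbar, ‖gradient f (msSolver f L K M m γ zbar) +
      (γ * ‖msSolver f L K M m γ zbar - zbar‖) • (msSolver f L K M m γ zbar - zbar)‖ ≤
      1 / 2 * (γ * ‖msSolver f L K M m γ zbar - zbar‖ * ‖msSolver f L K M m γ zbar - zbar‖))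
    {t : ℕ} (ht : 1 ≤ t) {st st' : ALenState E} (hst : st = alenIter f L 2 K M m γ z₀ z1 t)
    (hst' : st' = alenIter f L 2 K M m γ z₀ z1 (t + 1)) (hA : 0 ≤ st.A) (hlam : 0 < st.lam) :
    (st'.lam = st.lam / 2 ∧ √st.A + 1 / (2 * √st.lam) ≤ √st'.A ∧
      alenPotential f zstar st' ≤ alenPotential f zstar st) ∨
    (st'.lam = 2 * st.lam ∧ st.A ≤ st'.A ∧
      alenPotential f zstar st' + 3 / 8 * st.A * st.lam ^ 3 / γ ^ 2 ≤
        alenPotential f zstar st) := by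
  have ht0 : t ≠ 0 := by omega
  obtain ⟨ha, haA, hsqrt⟩ := weight_spec hA hlam
  rw [alenIter, ← hst] at hst'
  simp only [ht0, if_false] at hst'
  set a := 1 / (2 * st.lam) * (1 + √(1 + 4 * st.lam * st.A))
  set zbar := (st.A / (st.A + a)) • st.z + (a / (st.A + a)) • st.v with hzbar
  have hms := hMS zbar
  set y := msSolver f L K M m γ zbar
  set lamN := γ * ‖y - zbar‖ with hlamN
  have hlamN0 : 0 ≤ lamN := by positivity
  by_cases hle : lamN ≤ st.lam
  · rw [if_pos hle] at hst'
    left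
    rw [hst']
    refine ⟨by ring, hsqrt, ?_⟩
    have h := msPotential_down (zstar := zstar) hc hd hA ha hlamN0 hle haA st.z st.v y zbar
      hzbar hms
    have : 0 ≤ 3 / 8 * (st.A + a) * lamN * ‖y - zbar‖ ^ 2 := by positivity
    simp only [alenPotential]
    linarith
  · rw [if_neg hle] at hst'
    push Not at hle
    right
    rw [hst']
    refine ⟨rfl, ?_, ?_⟩
    · have : 0 ≤ st.lam / lamN * a := by positivity
      simp only
      linarith
    · have h := msPotential_up (zstar := zstar) hc hd hA ha hlam hle haA st.z st.v y zbar
        hzbar hms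
      -- In this branch the move is long: `γ * ‖y - zbar‖` exceeds the guess `st.lam`.
      have h2 : 3 / 8 * st.A * st.lam ^ 3 / γ ^ 2 ≤
          3 / 8 * (st.A + a) * st.lam * ‖y - zbar‖ ^ 2 := by
        rw [div_le_iff₀ (by positivity)]
        calc 3 / 8 * st.A * st.lam ^ 3 = 3 / 8 * st.A * st.lam * st.lam ^ 2 := by ring
          _ ≤ 3 / 8 * (st.A + a) * st.lam * lamN ^ 2 := by gcongr; linarith
          _ = _ := by rw [hlamN]; ring
      simp only [alenPotential]
      linarith

/-- Convergence of A-LEN. -/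
theorem alen_sub_min_le (hγ : 0 < γ) (hc : ConvexOn ℝ Set.univ f) (hd : Differentiable ℝ f)
    (hmin : ∀ z, f zstar ≤ f z)
    (hMS : ∀ zbar, ‖gradient f (msSolver f L K M m γ zbar) +
      (γ * ‖msSolver f L K M m γ zbar - zbar‖) • (msSolver f L K M m γ zbar - zbar)‖ ≤
      1 / 2 * (γ * ‖msSolver f L K M m γ zbar - zbar‖ * ‖msSolver f L K M m γ zbar - zbar‖))
    {T : ℕ} (hT : 1 ≤ T) (z₀ : E) :
    f (alen f L z₀ T 2 K M m γ).1 - f zstar ≤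
      γ * ‖z₀ - zstar‖ ^ 3 * (56 / T) ^ (7 / 2 : ℝ) := by
  have hT0 : (0 : ℝ) < T := by exact_mod_cast hT
  have hMS0 := hMS z₀
  rw [alen]
  set z1 := msSolver f L K M m γ z₀ with hz1
  by_cases hne : z1 = z₀
  · simp only [hne, if_true]
    rw [hne] at hMS0
    -- If the solver does not move, the Monteiro–Svaiter condition makes the gradient vanish, so
    -- stopping at `z₀` is optimal.
    have hp : gradient f z₀ = 0 := by simpa using hMS0
    have h := convexOn_add_inner_gradient_le hc hd z₀ zstar
    rw [hp, inner_zero_left] at h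
    have : 0 ≤ γ * ‖z₀ - zstar‖ ^ 3 * (56 / T : ℝ) ^ (7 / 2 : ℝ) := by positivity
    linarith
  simp only [hne, if_false]
  have hn : 0 < ‖z1 - z₀‖ := norm_sub_pos_iff.2 hne
  obtain ⟨hlam1, hA1, hV1⟩ := alenIter_one (L := L) (M := M) (K := K) (m := m) (zstar := zstar)
    hγ hc hd hne hMS0
  set st : ℕ → ALenState E := alenIter f L 2 K M m γ z₀ z1 with hst
  set D := ‖z₀ - zstar‖ with hD
  have hinv : ∀ t, 0 < (st t).lam ∧ 0 ≤ (st t).A := by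
    intro t
    rcases Nat.eq_zero_or_pos t with h0 | h0
    · subst h0
      exact ⟨by simp only [hst, alenIter]; positivity, le_rfl⟩
    induction t, h0 using Nat.le_induction with
    | base =>
      rw [hlam1, hA1]
      exact ⟨by positivity, by positivity⟩
    | succ t ht ih =>
      rcases alenIter_succ_step (zstar := zstar) (z₀ := z₀) (z1 := z1) hγ hc hd hMS ht rfl rfl
        ih.2 ih.1 with h | h
      · refine ⟨by rw [h.1]; exact half_pos ih.1, ?_⟩
        -- The square root of a negative number is `0`, which contradicts the strict growth of `√A`.
        by_contra hneg
        have h2 := h.2.1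
        rw [Real.sqrt_eq_zero_of_nonpos (not_le.1 hneg).le] at h2
        have h3 := Real.sqrt_nonneg (st t).A
        have h4 : 0 < 1 / (2 * √(st t).lam) := by
          have := Real.sqrt_pos.2 ih.1
          positivity
        linarith
      · exact ⟨by rw [h.1]; linarith [ih.1], ih.2.trans h.2.1⟩
  have hV0 : ∀ t, 0 ≤ alenPotential f zstar (st t) := fun t =>
    msPotential_nonneg hmin (hinv t).2 _ _
  have hVmono : ∀ t, 1 ≤ t → alenPotential f zstar (st t) ≤ 1 / 2 * D ^ 2 := by
    intro t ht
    induction t, ht using Nat.le_induction with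
    | base => nlinarith [sq_nonneg ‖z1 - z₀‖]
    | succ t ht ih =>
      have hl := (hinv t).1
      have hA := (hinv t).2
      rcases alenIter_succ_step (zstar := zstar) (z₀ := z₀) (z1 := z1) hγ hc hd hMS ht rfl rfl
        hA hl with h | h
      · exact h.2.2.trans ih
      · have : 0 ≤ 3 / 8 * (st t).A * (st t).lam ^ 3 / γ ^ 2 := by positivity
        exact le_trans (by linarith [h.2.2]) ih
  have hnD : ‖z1 - z₀‖ ≤ 2 * D := by
    refine le_of_sq_le_sq ?_ (by positivity)
    have := hV0 1
    nlinarith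
  have hD0 : 0 < D := by linarith
  -- Scale for the guesses: `‖z1 - z₀‖ ≤ 2 * D` makes `A_1 * G ≥ 1`, hence `b 1 ≥ 1` for the sixth
  -- root `b` of `A * G`.
  set G := 2 * γ * D with hG
  have hG0 : 0 < G := by positivity
  set b : ℕ → ℝ := fun t => ((st t).A * G) ^ (1 / 6 : ℝ) with hb
  have hAG : ∀ t, 0 ≤ (st t).A * G := fun t => mul_nonneg (hinv t).2 hG0.le
  have hb0 : ∀ t, 0 ≤ b t := fun t => Real.rpow_nonneg (hAG t) _
  have hb6 : ∀ t, b t ^ 6 = (st t).A * G := by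
    intro t
    rw [hb, ← Real.rpow_natCast, ← Real.rpow_mul (hAG t)]
    norm_num
  have hb3 : ∀ t, b t ^ 3 = √(st t).A * √G := by
    intro t
    rw [← Real.sqrt_mul (hinv t).2, ← hb6, show b t ^ 6 = (b t ^ 3) ^ 2 by ring,
      Real.sqrt_sq (pow_nonneg (hb0 t) 3)]
  have hiter := iterations_le_of_growth (b := b) (ℓ := fun t => (st t).lam / G)
    (X := fun t => (1 / 2 * D ^ 2 - alenPotential f zstar (st t)) / D ^ 2) hT hb0
    (by
      refine le_of_pow_le_pow_left₀ (n := 6) (by norm_num) (hb0 1) ?_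
      rw [hb6, hA1, one_pow, one_div_mul_eq_div, le_div_iff₀ (by positivity), hG]
      nlinarith)
    (fun t => div_pos (hinv t).1 hG0)
    (by
      rw [hb6, hA1, hlam1]
      field_simp)
    (div_nonneg (by linarith [hVmono 1 le_rfl]) (by positivity))
    (by
      rw [div_le_one (by positivity)]
      nlinarith [hV0 T])
    (by
      intro t ht
      have hl := (hinv t).1
      have hA := (hinv t).2
      rcases alenIter_succ_step (zstar := zstar) (z₀ := z₀) (z1 := z1) hγ hc hd hMS ht rfl rfl
        hA hl with ⟨h1, h2, h3⟩ | ⟨h1, h2, h3⟩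
      · left
        refine ⟨?_, ?_, ?_⟩
        · rw [hb3, hb3, Real.sqrt_div hl.le]
          have hs := Real.sqrt_pos.2 hl
          have hsG := Real.sqrt_pos.2 hG0
          have := mul_le_mul_of_nonneg_right h2 hsG.le
          change (√(st t).A + 1 / (2 * √(st t).lam)) * √G ≤ _ at this
          refine le_trans (le_of_eq ?_) this
          field_simp
        · simp only [hst, h1]; ring
        · gcongr
      · right
        refine ⟨?_, ?_, ?_⟩
        · simp only [hb]
          exact Real.rpow_le_rpow (hAG t) (by gcongr) (by norm_num)
        · simp only [hst, h1]; ring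
        · rw [hb6]
          have he : (st t).A * G * ((st t).lam / G) ^ 3 =
              (st t).A * (st t).lam ^ 3 / γ ^ 2 / 4 / D ^ 2 := by
            rw [hG]; field_simp; norm_num
          rw [he, ← add_div]
          gcongr
          have : 0 ≤ (st t).A * (st t).lam ^ 3 / γ ^ 2 := by positivity
          have he2 : 3 / 8 * (st t).A * (st t).lam ^ 3 / γ ^ 2 =
            3 / 8 * ((st t).A * (st t).lam ^ 3 / γ ^ 2) := by ring
          rw [he2] at h3
          linarith)
  have hpow : (T / 56 : ℝ) ^ (7 / 2 : ℝ) ≤ (st T).A * G := by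
    have h1 : (T / 56 : ℝ) ≤ b T ^ (12 / 7 : ℝ) := by linarith
    calc (T / 56 : ℝ) ^ (7 / 2 : ℝ) ≤ (b T ^ (12 / 7 : ℝ)) ^ (7 / 2 : ℝ) :=
          Real.rpow_le_rpow (by positivity) h1 (by norm_num)
      _ = b T ^ (6 : ℕ) := by
          rw [← Real.rpow_mul (hb0 T), ← Real.rpow_natCast]; norm_num
      _ = _ := hb6 T
  have hinvpow : (56 / T : ℝ) ^ (7 / 2 : ℝ) * (T / 56 : ℝ) ^ (7 / 2 : ℝ) = 1 := by
    rw [← Real.mul_rpow (by positivity) (by positivity)]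
    have : (56 / T * (T / 56) : ℝ) = 1 := by field_simp
    rw [this, Real.one_rpow]
  have hgap : (st T).A * (f (st T).z - f zstar) ≤ 1 / 2 * D ^ 2 := by
    have h := hVmono T hT
    simp only [alenPotential, msPotential] at h
    nlinarith [sq_nonneg ‖(st T).v - zstar‖]
  set Q := (56 / T : ℝ) ^ (7 / 2 : ℝ) with hQ
  have hQ0 : 0 < Q := by positivity
  have hδ : 0 ≤ f (st T).z - f zstar := sub_nonneg.2 (hmin _)
  calc f (st T).z - f zstar
      = Q * (T / 56 : ℝ) ^ (7 / 2 : ℝ) * (f (st T).z - f zstar) := by rw [hinvpow, one_mul]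
    _ ≤ Q * ((st T).A * G) * (f (st T).z - f zstar) := by gcongr
    _ = Q * G * ((st T).A * (f (st T).z - f zstar)) := by ring
    _ ≤ Q * G * (1 / 2 * D ^ 2) := by gcongr
    _ = _ := by rw [hG]; ring

end Acceleration

/-! ### Superlinear recursion and the number of epochs. -/

section Epochs

/-- The comparison sequence for order `3/2`. At `s = 0` the right side is `1 / 8`, which is where
the constant of the recursion comes from. -/
theorem half_rpow_succ_sq (s : ℕ) :
    ((1 / 2 : ℝ) ^ ((3 / 2 : ℝ) ^ (s + 1))) ^ 2 = ((1 / 2 : ℝ) ^ ((3 / 2 : ℝ) ^ s)) ^ 3 := by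
  rw [← Real.rpow_mul_natCast (by norm_num), ← Real.rpow_mul_natCast (by norm_num), pow_succ]
  congr 1
  push_cast
  ring

/-- A superlinear recursion of order `3 / 2`. -/
theorem le_half_rpow_mul_of_recursion {c : ℝ} {d : ℕ → ℝ} (hc : 0 < c) (hd : ∀ s, 0 ≤ d s)
    (h1 : d 1 ^ 2 ≤ 1 / 8 * c ^ 2) (h : ∀ s, 1 ≤ s → c * d (s + 1) ^ 2 ≤ 1 / 8 * d s ^ 3)
    {s : ℕ} (hs : 1 ≤ s) : d s ≤ (1 / 2 : ℝ) ^ ((3 / 2 : ℝ) ^ s) * c := by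
  induction s, hs using Nat.le_induction with
  | base =>
    refine le_of_sq_le_sq ?_ (by positivity)
    have := half_rpow_succ_sq 0
    rw [mul_pow, this]
    norm_num at h1 ⊢
    exact h1
  | succ s hs ih =>
    refine le_of_sq_le_sq ?_ (by positivity)
    rw [mul_pow, half_rpow_succ_sq]
    set e := (1 / 2 : ℝ) ^ ((3 / 2 : ℝ) ^ s)
    have he : 0 ≤ e := by positivity
    refine le_of_mul_le_mul_left ?_ hc
    calc c * d (s + 1) ^ 2 ≤ 1 / 8 * d s ^ 3 := h s hs
      _ ≤ 1 / 8 * (e * c) ^ 3 := by gcongr; exact hd s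
      _ ≤ c * (e ^ 3 * c ^ 2) := by
        have : 0 ≤ e ^ 3 * c ^ 3 := by positivity
        nlinarith

theorem one_lt_logb_two_inv {ε : ℝ} (hε : 0 < ε) (hε2 : ε < 1 / 2) : 1 < Real.logb 2 (1 / ε) := by
  rw [Real.lt_logb_iff_rpow_lt (by norm_num) (by positivity), Real.rpow_one,
    lt_div_iff₀ hε]
  linarith

theorem one_le_numEpochs {ε : ℝ} (hε : 0 < ε) (hε2 : ε < 1 / 2) : 1 ≤ numEpochs ε := by
  rw [numEpochs, Nat.one_le_ceil_iff]
  exact Real.logb_pos (by norm_num) (one_lt_logb_two_inv hε hε2)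

theorem half_rpow_numEpochs_le {ε : ℝ} (hε : 0 < ε) (hε2 : ε < 1 / 2) :
    (1 / 2 : ℝ) ^ ((3 / 2 : ℝ) ^ numEpochs ε) ≤ ε := by
  have h1 := one_lt_logb_two_inv hε hε2
  have h2 : Real.logb 2 (1 / ε) ≤ (3 / 2 : ℝ) ^ numEpochs ε := by
    have h3 := Nat.le_ceil (Real.logb (3 / 2) (Real.logb 2 (1 / ε)))
    rw [Real.logb_le_iff_le_rpow (by norm_num) (by linarith), Real.rpow_natCast] at h3
    exact h3
  calc (1 / 2 : ℝ) ^ ((3 / 2 : ℝ) ^ numEpochs ε) ≤ (1 / 2 : ℝ) ^ Real.logb 2 (1 / ε) :=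
        Real.rpow_le_rpow_of_exponent_ge (by norm_num) (by norm_num) h2
    _ = ε := by
        rw [one_div, Real.inv_rpow (by norm_num), Real.rpow_logb (by norm_num) (by norm_num)
          (by positivity), one_div, inv_inv]

/-- For `ε ≤ 1 / 4` the double logarithm is at least `1 / 4`, so it absorbs the rounding and the
base changes: `3 * (y + 3 / 4) + 1 ≤ 16 * y`. -/
theorem numEpochs_le {ε : ℝ} (hε : 0 < ε) (hε4 : ε ≤ 1 / 4) :
    (numEpochs ε : ℝ) ≤ 16 * Real.log (Real.log (1 / ε)) := by
  have h1 := one_lt_logb_two_inv hε (by linarith)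
  have hpos : 0 < Real.logb (3 / 2) (Real.logb 2 (1 / ε)) := Real.logb_pos (by norm_num) h1
  have h2 : (numEpochs ε : ℝ) < Real.logb (3 / 2) (Real.logb 2 (1 / ε)) + 1 :=
    Nat.ceil_lt_add_one hpos.le
  have hlog2 : 0 < Real.log 2 := Real.log_pos (by norm_num)
  have hx : 4 / 3 ≤ Real.log (1 / ε) := by
    have h3 : Real.log 4 ≤ Real.log (1 / ε) := by
      apply Real.log_le_log (by norm_num)
      rw [le_div_iff₀ hε]
      linarith
    have h4 : Real.log 4 = 2 * Real.log 2 := by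
      rw [show (4 : ℝ) = 2 ^ 2 by norm_num, Real.log_pow]; norm_num
    linarith [Real.log_two_gt_d9]
  set x := Real.log (1 / ε)
  have hy : 1 / 4 ≤ Real.log x := by
    have h3 : Real.log (4 / 3) ≤ Real.log x := Real.log_le_log (by norm_num) hx
    have h4 := Real.one_sub_inv_le_log_of_pos (show (0 : ℝ) < 4 / 3 by norm_num)
    norm_num at h4
    linarith
  have h32 : 1 / 3 ≤ Real.log (3 / 2) := by
    have h4 := Real.one_sub_inv_le_log_of_pos (show (0 : ℝ) < 3 / 2 by norm_num)
    norm_num at h4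
    linarith
  have hll : -Real.log (Real.log 2) ≤ 3 / 4 := by
    have h3 : Real.log (1 / 2) ≤ Real.log (Real.log 2) :=
      Real.log_le_log (by norm_num) (by linarith [Real.log_two_gt_d9])
    rw [one_div, Real.log_inv] at h3
    linarith [Real.log_two_lt_d9]
  have hlb : Real.logb (3 / 2) (Real.logb 2 (1 / ε)) ≤ 3 * (Real.log x + 3 / 4) := by
    have he : Real.logb (3 / 2) (Real.logb 2 (1 / ε)) =
        (Real.log x - Real.log (Real.log 2)) / Real.log (3 / 2) := by
      rw [Real.logb, Real.logb, Real.log_div (by positivity) hlog2.ne']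
    rw [he, div_le_iff₀ (by linarith)]
    nlinarith
  linarith

end Epochs

/-! ### Step counts and convergence of A-LEN-restart. -/

section Restart

variable {E : Type*} [NormedAddCommGroup E] [InnerProductSpace ℝ E] [CompleteSpace E]
  {f : E → ℝ} {zstar : E} {μ L M γ : ℝ} {K m T : ℕ}

/-- The solver call made before the loop serves iteration `0`, so there is exactly one call per
iteration. -/
theorem alenIter_steps (z₀ z1 : E) (t : ℕ) :
    (alenIter f L 2 K M m γ z₀ z1 (t + 1)).steps = (t + 1) * msSolverSteps K m := by
  induction t with
  | zero => simp [alenIter]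
  | succ t ih =>
    rw [alenIter]
    simp only [Nat.succ_ne_zero, if_false, ih]
    split_ifs <;> simp only <;> ring

theorem alen_steps_le (hT : 1 ≤ T) (z₀ : E) :
    (alen f L z₀ T 2 K M m γ).2 ≤ T * msSolverSteps K m := by
  rw [alen]
  split_ifs
  · exact Nat.le_mul_of_pos_left _ hT
  · obtain ⟨t, rfl⟩ := Nat.exists_eq_add_of_le' hT
    exact (alenIter_steps z₀ _ t).le

theorem alenRestart_steps_le (hT : 1 ≤ T) (z₀ : E) (s : ℕ) :
    (alenRestart f L z₀ T 2 K M m γ s).2 ≤ s * (T * msSolverSteps K m) := by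
  induction s with
  | zero => simp [alenRestart]
  | succ s ih =>
    rw [alenRestart]
    have := alen_steps_le (f := f) (L := L) (K := K) (M := M) (m := m) (γ := γ) hT
      (alenRestart f L z₀ T 2 K M m γ s).1
    rw [Nat.succ_mul]
    exact Nat.add_le_add ih this

theorem msSolverSteps_le (hm : 1 ≤ m) (hK : m ≤ K) : (msSolverSteps K m : ℝ) ≤ 4 * K := by
  have hm0 : (0 : ℝ) < m := by exact_mod_cast hm
  have hm1 : (1 : ℝ) ≤ m := by exact_mod_cast hm
  have hmK : (m : ℝ) ≤ K := by exact_mod_cast hK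
  have h1 : (⌈(K : ℝ) / m⌉₊ : ℝ) * m ≤ (K / m + 1) * m := by
    gcongr
    exact (Nat.ceil_lt_add_one (by positivity)).le
  have h2 : ((K : ℝ) / m + 1) * m = K + m := by field_simp
  rw [msSolverSteps]
  push_cast
  linarith

variable [FiniteDimensional ℝ E]

/-- One call of A-LEN on a strongly convex function. -/
theorem norm_alen_sub_sq_le (hμ : 0 < μ) (hL : 0 < L) (hm : 1 ≤ m)
    (hsc : StrongConvexOn Set.univ μ f) (hf : HasLipschitzHessian L f)
    (hmin : ∀ z, f zstar ≤ f z) (hγ : γ = L / m) (hM : M = 6 * m * (L + 2 * γ))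
    (hK : 100000 * (m * (1 + Real.log m)) ≤ (K : ℝ)) (hT : 1 ≤ T) (z₀ : E) :
    ‖(alen f L z₀ T 2 K M m γ).1 - zstar‖ ^ 2 ≤
      2 * (γ / μ) * ‖z₀ - zstar‖ ^ 3 * (56 / T) ^ (7 / 2 : ℝ) := by
  have hm0 : (0 : ℝ) < m := by exact_mod_cast hm
  have hγ0 : 0 < γ := by rw [hγ]; positivity
  have hc : ConvexOn ℝ Set.univ f := (hsc.strictConvexOn hμ).convexOn
  have hMS : ∀ zbar, ‖gradient f (msSolver f L K M m γ zbar) +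
      (γ * ‖msSolver f L K M m γ zbar - zbar‖) • (msSolver f L K M m γ zbar - zbar)‖ ≤
      1 / 2 * (γ * ‖msSolver f L K M m γ zbar - zbar‖ *
        ‖msSolver f L K M m γ zbar - zbar‖) := by
    intro zbar
    have h := norm_gradient_proxFun_msSolver_le hL hm hf hc hγ hM hK zbar
    rw [gradient_proxFun hf.differentiable] at h
    simp only [smul_smul] at h
    refine h.trans (le_of_eq ?_)
    ring
  have h1 := alen_sub_min_le hγ0 hc hf.differentiable hmin hMS hT z₀
  have h2 := half_mul_norm_sq_le_sub_of_strongConvexOn hsc hmin (alen f L z₀ T 2 K M m γ).1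
  have h3 := h2.trans h1
  have h4 : 2 * (γ / μ) * ‖z₀ - zstar‖ ^ 3 * (56 / T : ℝ) ^ (7 / 2 : ℝ) =
      (γ * ‖z₀ - zstar‖ ^ 3 * (56 / T : ℝ) ^ (7 / 2 : ℝ)) / (μ / 2) := by field_simp
  rw [h4, le_div_iff₀ (by positivity)]
  linarith

/-- The choice of the number of iterations. -/
theorem mul_rpow_le_of_iterations (hT : 1 ≤ T) {Y : ℝ} (hY : 0 ≤ Y)
    (h : 224 * Y ^ (2 / 7 : ℝ) ≤ (T : ℝ)) : Y * (56 / T : ℝ) ^ (7 / 2 : ℝ) ≤ 1 / 16 := by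
  have hT0 : (0 : ℝ) < T := by exact_mod_cast hT
  have h1 : Y ≤ (T / 224 : ℝ) ^ (7 / 2 : ℝ) := by
    have h2 : Y ^ (2 / 7 : ℝ) ≤ T / 224 := by linarith
    calc Y = (Y ^ (2 / 7 : ℝ)) ^ (7 / 2 : ℝ) := by rw [← Real.rpow_mul hY]; norm_num
      _ ≤ _ := Real.rpow_le_rpow (by positivity) h2 (by norm_num)
  calc Y * (56 / T : ℝ) ^ (7 / 2 : ℝ)
      ≤ (T / 224 : ℝ) ^ (7 / 2 : ℝ) * (56 / T : ℝ) ^ (7 / 2 : ℝ) := by gcongr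
    -- `224 = 4 * 56`.
    _ = (1 / 4 : ℝ) ^ (7 / 2 : ℝ) := by
        rw [← Real.mul_rpow (by positivity) (by positivity)]
        congr 1
        field_simp
        norm_num
    _ ≤ (1 / 4 : ℝ) ^ (2 : ℝ) :=
        Real.rpow_le_rpow_of_exponent_ge (by norm_num) (by norm_num) (by norm_num)
    _ = 1 / 16 := by norm_num

/-- Superlinear convergence of A-LEN-restart. -/
theorem norm_alenRestart_sub_le (hμ : 0 < μ) (hL : 0 < L) (hm : 1 ≤ m)
    (hsc : StrongConvexOn Set.univ μ f) (hf : HasLipschitzHessian L f)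
    (hmin : ∀ z, f zstar ≤ f z) (hγ : γ = L / m) (hM : M = 6 * m * (L + 2 * γ))
    (hK : 100000 * (m * (1 + Real.log m)) ≤ (K : ℝ)) (hT : 1 ≤ T) (z₀ : E)
    {c Y : ℝ} (hc : 0 < c) (hcY : c ≤ Y) (hYc : ‖z₀ - zstar‖ ^ 3 ≤ Y * c ^ 2)
    (hTY : 224 * (γ * Y / μ) ^ (2 / 7 : ℝ) ≤ (T : ℝ)) {s : ℕ} (hs : 1 ≤ s) :
    ‖(alenRestart f L z₀ T 2 K M m γ s).1 - zstar‖ ≤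
      (1 / 2 : ℝ) ^ ((3 / 2 : ℝ) ^ s) * c := by
  have hm0 : (0 : ℝ) < m := by exact_mod_cast hm
  have hγ0 : 0 < γ := by rw [hγ]; positivity
  have hY : 0 < Y := hc.trans_le hcY
  -- `Y` sets the scale of the iteration count and `c` that of the error: `c ≤ Y` drives the
  -- recursion and `‖z₀ - zstar‖ ^ 3 ≤ Y * c ^ 2` starts it. Relative accuracy takes `c = Y = D`,
  -- absolute accuracy `c = 1`, `Y = D ^ 3`.
  have hstep : ∀ s, Y * ‖(alenRestart f L z₀ T 2 K M m γ (s + 1)).1 - zstar‖ ^ 2 ≤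
      1 / 8 * ‖(alenRestart f L z₀ T 2 K M m γ s).1 - zstar‖ ^ 3 := by
    intro s
    have h1 := norm_alen_sub_sq_le hμ hL hm hsc hf hmin hγ hM hK hT
      (alenRestart f L z₀ T 2 K M m γ s).1
    have h2 := mul_rpow_le_of_iterations hT (Y := γ * Y / μ) (by positivity) hTY
    change Y * ‖(alen f L (alenRestart f L z₀ T 2 K M m γ s).1 T 2 K M m γ).1 - zstar‖ ^ 2 ≤ _
    have hr := norm_nonneg ((alenRestart f L z₀ T 2 K M m γ s).1 - zstar)
    generalize ‖(alenRestart f L z₀ T 2 K M m γ s).1 - zstar‖ = r at *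
    calc _ ≤ Y * (2 * (γ / μ) * r ^ 3 * (56 / T) ^ (7 / 2 : ℝ)) := by gcongr
      _ = 2 * r ^ 3 * (γ * Y / μ * (56 / T) ^ (7 / 2 : ℝ)) := by ring
      _ ≤ 2 * r ^ 3 * (1 / 16) := by
          gcongr
      _ = _ := by ring
  refine le_half_rpow_mul_of_recursion
    (d := fun s => ‖(alenRestart f L z₀ T 2 K M m γ s).1 - zstar‖) hc
    (fun s => norm_nonneg _) ?_ (fun s _ => ?_) hs
  · have h := hstep 0
    change Y * ‖(alenRestart f L z₀ T 2 K M m γ 1).1 - zstar‖ ^ 2 ≤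
      1 / 8 * ‖z₀ - zstar‖ ^ 3 at h
    refine le_of_mul_le_mul_left ?_ hY
    linarith
  · refine le_trans ?_ (hstep s)
    gcongr

/-- If started at the minimizer, the method stays there. -/
theorem norm_alenRestart_sub_eq_zero (hμ : 0 < μ) (hL : 0 < L) (hm : 1 ≤ m)
    (hsc : StrongConvexOn Set.univ μ f) (hf : HasLipschitzHessian L f)
    (hmin : ∀ z, f zstar ≤ f z) (hγ : γ = L / m) (hM : M = 6 * m * (L + 2 * γ))
    (hK : 100000 * (m * (1 + Real.log m)) ≤ (K : ℝ)) (hT : 1 ≤ T) {z₀ : E}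
    (h0 : ‖z₀ - zstar‖ = 0) (s : ℕ) :
    ‖(alenRestart f L z₀ T 2 K M m γ s).1 - zstar‖ = 0 := by
  induction s with
  | zero => exact h0
  | succ s ih =>
    have h1 := norm_alen_sub_sq_le hμ hL hm hsc hf hmin hγ hM hK hT
      (alenRestart f L z₀ T 2 K M m γ s).1
    rw [ih] at h1
    norm_num at h1
    rw [alenRestart]
    exact norm_eq_zero.2 h1

end Restart

/-! ### Total work. -/

section Complexity

/-- Bounds on the work of all epochs in terms of the work of a single one. -/
theorem total_steps_le {E : Type*} [NormedAddCommGroup E] [InnerProductSpace ℝ E] [CompleteSpace E]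
    {f : E → ℝ} {L M γ : ℝ} {K m T : ℕ} (hm : 1 ≤ m) (hK : m ≤ K) (hT : 1 ≤ T) (z₀ : E)
    {ε : ℝ} (hε : 0 < ε) (hε4 : ε ≤ 1 / 4) {c W : ℝ} (hW : (m : ℝ) + T * K ≤ c * W) :
    (numEpochs ε : ℝ) * (m + T * K) ≤ 64 * c * (W * Real.log (Real.log (1 / ε))) ∧
    ((alenRestart f L z₀ T 2 K M m γ (numEpochs ε)).2 : ℝ) ≤
      64 * c * (W * Real.log (Real.log (1 / ε))) := by
  have hS := numEpochs_le hε hε4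
  have hl : 0 ≤ Real.log (Real.log (1 / ε)) := by
    have : (0 : ℝ) ≤ numEpochs ε := by positivity
    linarith
  have hW0 : 0 ≤ (m : ℝ) + T * K := by positivity
  have h1 : 4 * ((numEpochs ε : ℝ) * (m + T * K)) ≤
      64 * c * (W * Real.log (Real.log (1 / ε))) := by
    calc 4 * ((numEpochs ε : ℝ) * (m + T * K))
        ≤ 4 * ((16 * Real.log (Real.log (1 / ε))) * (c * W)) := by gcongr
      _ = _ := by ring
  refine ⟨le_trans ?_ h1, le_trans ?_ h1⟩
  · have : 0 ≤ (numEpochs ε : ℝ) * (m + T * K) := by positivity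
    linarith
  · have h2 : ((alenRestart f L z₀ T 2 K M m γ (numEpochs ε)).2 : ℝ) ≤
        numEpochs ε * (T * msSolverSteps K m) := by
      exact_mod_cast alenRestart_steps_le hT z₀ (numEpochs ε)
    have h3 := msSolverSteps_le hm hK
    calc _ ≤ (numEpochs ε : ℝ) * (T * msSolverSteps K m) := h2
      _ ≤ numEpochs ε * (T * (4 * K)) := by gcongr
      _ = 4 * (numEpochs ε * (0 + T * K)) := by ring
      _ ≤ _ := by gcongr; positivity

/-- The gain from lazy Hessians: `γ = L / m` lowers the power of `m` from `1` to `5/7`. -/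
theorem mul_div_rpow_eq {L μ γ : ℝ} {m : ℕ} (hL : 0 < L) (hμ : 0 < μ) (hm : 1 ≤ m)
    (hγ : γ = L / m) :
    (m : ℝ) * (γ / μ) ^ (2 / 7 : ℝ) = (m : ℝ) ^ (5 / 7 : ℝ) * (L / μ) ^ (2 / 7 : ℝ) := by
  have hm0 : (0 : ℝ) < m := by exact_mod_cast hm
  have h1 : γ / μ = L / μ / m := by rw [hγ]; field_simp
  have h2 : (m : ℝ) ^ (5 / 7 : ℝ) = m / (m : ℝ) ^ (2 / 7 : ℝ) := by
    rw [show (5 / 7 : ℝ) = 1 - 2 / 7 by norm_num, Real.rpow_sub hm0, Real.rpow_one]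
  rw [h1, Real.div_rpow (by positivity) hm0.le, h2]
  ring

/-- Absolute values appear because the constants `CK`, `CT` are arbitrary reals. -/
theorem iterations_mul_le {CK CT k t w x : ℝ} (hk : 0 ≤ k) (hw : 0 ≤ w) (hx : 0 ≤ x)
    (hkw : k ≤ CK * w) (htx : t ≤ CT * x) : t * k ≤ |CK| * |CT| * (w * x) := by
  have h1 : k ≤ |CK| * w := hkw.trans (by gcongr; exact le_abs_self _)
  have h2 : t ≤ |CT| * x := htx.trans (by gcongr; exact le_abs_self _)
  calc t * k ≤ (|CT| * x) * (|CK| * w) := by gcongr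
    _ = _ := by ring

end Complexity

end LazyNewton

/-! ### The main theorem. -/

theorem theorem6 :
    ∃ cK cT : ℝ, 0 < cK ∧ 0 < cT ∧ ∀ CK CT : ℝ, ∃ C : ℝ, 0 < C ∧
      ∀ (d : ℕ) (f : EuclideanSpace ℝ (Fin d) → ℝ) (μ L : ℝ) (m : ℕ)
        (z₀ zstar : EuclideanSpace ℝ (Fin d)) (γ M : ℝ) (K T : ℕ),
        0 < μ → 0 < L → 1 ≤ m →
        StrongConvexOn Set.univ μ f →
        LazyNewton.HasLipschitzHessian L f →
        IsMinOn f Set.univ zstar →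
        γ = L / m →
        M = 6 * m * (L + 2 * γ) →
        cK * (m * (1 + Real.log m)) ≤ K →
        1 ≤ T →
        cT * (γ * ‖z₀ - zstar‖ / μ) ^ (2 / 7 : ℝ) ≤ T →
        -- superlinear convergence
        (∀ s : ℕ, 1 ≤ s →
          ‖(LazyNewton.alenRestart f L z₀ T 2 K M m γ s).1 - zstar‖ ^ 2 ≤
            (1 / 2 : ℝ) ^ ((3 / 2 : ℝ) ^ s) * ‖z₀ - zstar‖ ^ 2) ∧
        -- accuracy after `⌈log_{3/2} log_2 (1 / ε)⌉` epochs
        (∀ ε : ℝ, 0 < ε → ε < 1 / 2 →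
          ‖(LazyNewton.alenRestart f L z₀ T 2 K M m γ (LazyNewton.numEpochs ε)).1 - zstar‖ ≤
            ε * ‖z₀ - zstar‖) ∧
        (cT * (γ * ‖z₀ - zstar‖ ^ 3 / μ) ^ (2 / 7 : ℝ) ≤ T →
          ∀ ε : ℝ, 0 < ε → ε < 1 / 2 →
          ‖(LazyNewton.alenRestart f L z₀ T 2 K M m γ (LazyNewton.numEpochs ε)).1 - zstar‖ ≤ ε) ∧
        -- total number of steps
        ((K : ℝ) ≤ CK * (m * (1 + Real.log m)) →
          (T : ℝ) ≤ CT * (γ / μ) ^ (2 / 7 : ℝ) →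
          ∀ ε : ℝ, 0 < ε → ε ≤ 1 / 4 →
          (LazyNewton.numEpochs ε : ℝ) * (m + T * K) ≤
            C * ((m + (m : ℝ) ^ (5 / 7 : ℝ) * (1 + Real.log m) * (L / μ) ^ (2 / 7 : ℝ)) *
              Real.log (Real.log (1 / ε))) ∧
          ((LazyNewton.alenRestart f L z₀ T 2 K M m γ (LazyNewton.numEpochs ε)).2 : ℝ) ≤
            C * ((m + (m : ℝ) ^ (5 / 7 : ℝ) * (1 + Real.log m) * (L / μ) ^ (2 / 7 : ℝ)) *
              Real.log (Real.log (1 / ε)))) ∧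
        -- the same when `γ / μ` may be so small that only the rounding makes `T` positive
        ((K : ℝ) ≤ CK * (m * (1 + Real.log m)) →
          (T : ℝ) ≤ CT * (1 + (γ / μ) ^ (2 / 7 : ℝ)) →
          ∀ ε : ℝ, 0 < ε → ε ≤ 1 / 4 →
          (LazyNewton.numEpochs ε : ℝ) * (m + T * K) ≤
            C * ((m + (m : ℝ) ^ (5 / 7 : ℝ) * (L / μ) ^ (2 / 7 : ℝ)) * (1 + Real.log m) *
              Real.log (Real.log (1 / ε))) ∧
          ((LazyNewton.alenRestart f L z₀ T 2 K M m γ (LazyNewton.numEpochs ε)).2 : ℝ) ≤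
            C * ((m + (m : ℝ) ^ (5 / 7 : ℝ) * (L / μ) ^ (2 / 7 : ℝ)) * (1 + Real.log m) *
              Real.log (Real.log (1 / ε)))) := by
  -- In the last constant, `64 = 16 * 4` combines the epoch count with the cost `4 * K` per solver
  -- call; the summand `1` pays for `m`.
  refine ⟨100000, 224, by norm_num, by norm_num, fun CK CT => ⟨64 * (1 + |CK| * |CT|),
    by positivity, ?_⟩⟩
  intro d f μ L m z₀ zstar γ M K T hμ hL hm hsc hf hmin' hγ hM hK hT hTD
  have hmin : ∀ z, f zstar ≤ f z := fun z => hmin' (Set.mem_univ z)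
  have hm1 : (1 : ℝ) ≤ m := by exact_mod_cast hm
  have hm0 : (0 : ℝ) < m := by linarith
  have hlog : 0 ≤ Real.log m := Real.log_nonneg hm1
  have hγ0 : 0 < γ := by rw [hγ]; positivity
  have hmK : m ≤ K := by
    have : (m : ℝ) ≤ K := le_trans (by nlinarith) hK
    exact_mod_cast this
  have hkey : ∀ s : ℕ, 1 ≤ s → ‖(LazyNewton.alenRestart f L z₀ T 2 K M m γ s).1 - zstar‖ ≤
      (1 / 2 : ℝ) ^ ((3 / 2 : ℝ) ^ s) * ‖z₀ - zstar‖ := by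
    intro s hs
    rcases (norm_nonneg (z₀ - zstar)).eq_or_lt with h0 | h0
    · rw [LazyNewton.norm_alenRestart_sub_eq_zero hμ hL hm hsc hf hmin hγ hM hK hT h0.symm s]
      positivity
    · exact LazyNewton.norm_alenRestart_sub_le hμ hL hm hsc hf hmin hγ hM hK hT z₀ h0 le_rfl
        (le_of_eq (by ring)) hTD hs
  have hacc : ∀ ε : ℝ, 0 < ε → ε < 1 / 2 →
      ‖(LazyNewton.alenRestart f L z₀ T 2 K M m γ (LazyNewton.numEpochs ε)).1 - zstar‖ ≤
        ε * ‖z₀ - zstar‖ := by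
    intro ε hε hε2
    refine (hkey _ (LazyNewton.one_le_numEpochs hε hε2)).trans ?_
    gcongr
    exact LazyNewton.half_rpow_numEpochs_le hε hε2
  have hw0 : 0 ≤ (m : ℝ) * (1 + Real.log m) := by positivity
  have hx0 : 0 ≤ (γ / μ) ^ (2 / 7 : ℝ) := by positivity
  have hmul := LazyNewton.mul_div_rpow_eq hL hμ hm hγ
  have hmul0 : 0 ≤ (m : ℝ) ^ (5 / 7 : ℝ) * (L / μ) ^ (2 / 7 : ℝ) := by positivity
  have hC0 : 0 ≤ |CK| * |CT| := by positivity
  refine ⟨fun s hs => ?_, hacc, fun hTD3 ε hε hε2 => ?_, fun hKu hTu ε hε hε4 => ?_,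
    fun hKu hTu ε hε hε4 => ?_⟩
  · have he0 : (0 : ℝ) ≤ (1 / 2 : ℝ) ^ ((3 / 2 : ℝ) ^ s) := by positivity
    have he1 : (1 / 2 : ℝ) ^ ((3 / 2 : ℝ) ^ s) ≤ 1 :=
      Real.rpow_le_one (by norm_num) (by norm_num) (by positivity)
    -- The distance itself contracts by the stated factor, so squaring leaves one factor to spare.
    calc _ ≤ ((1 / 2 : ℝ) ^ ((3 / 2 : ℝ) ^ s) * ‖z₀ - zstar‖) ^ 2 := by
          gcongr; exact hkey s hs
      _ = (1 / 2 : ℝ) ^ ((3 / 2 : ℝ) ^ s) * (1 / 2 : ℝ) ^ ((3 / 2 : ℝ) ^ s) *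
            ‖z₀ - zstar‖ ^ 2 := by ring
      _ ≤ _ := by
          gcongr
          exact mul_le_of_le_one_left he0 he1
  -- For `D ≤ 1` relative accuracy suffices; for `D ≥ 1` the scale `Y = D ^ 3` is admissible with `c
  -- = 1`.
  · rcases le_total ‖z₀ - zstar‖ 1 with h1 | h1
    · exact (hacc ε hε hε2).trans (mul_le_of_le_one_right hε.le h1)
    · have h := LazyNewton.norm_alenRestart_sub_le hμ hL hm hsc hf hmin hγ hM hK hT z₀
        (c := 1) (Y := ‖z₀ - zstar‖ ^ 3) one_pos (one_le_pow₀ h1) (le_of_eq (by ring)) hTD3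
        (LazyNewton.one_le_numEpochs hε hε2)
      rw [mul_one] at h
      exact h.trans (LazyNewton.half_rpow_numEpochs_le hε hε2)
  · refine LazyNewton.total_steps_le hm hmK hT z₀ hε hε4 ?_
    have h := LazyNewton.iterations_mul_le (Nat.cast_nonneg K) hw0 hx0 hKu hTu
    have he : (m : ℝ) * (1 + Real.log m) * (γ / μ) ^ (2 / 7 : ℝ) =
        (m : ℝ) ^ (5 / 7 : ℝ) * (1 + Real.log m) * (L / μ) ^ (2 / 7 : ℝ) := by
      rw [mul_right_comm, hmul]; ring
    rw [he] at h
    have h0 : 0 ≤ (m : ℝ) ^ (5 / 7 : ℝ) * (1 + Real.log m) * (L / μ) ^ (2 / 7 : ℝ) := by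
      positivity
    nlinarith
  · refine LazyNewton.total_steps_le hm hmK hT z₀ hε hε4 ?_
    have h := LazyNewton.iterations_mul_le (Nat.cast_nonneg K) hw0
      (by positivity : 0 ≤ 1 + (γ / μ) ^ (2 / 7 : ℝ)) hKu hTu
    have he : (m : ℝ) * (1 + Real.log m) * (1 + (γ / μ) ^ (2 / 7 : ℝ)) =
        (m + (m : ℝ) ^ (5 / 7 : ℝ) * (L / μ) ^ (2 / 7 : ℝ)) * (1 + Real.log m) := by
      rw [← hmul]; ring
    rw [he] at h
    have h0 : (m : ℝ) ≤
        (m + (m : ℝ) ^ (5 / 7 : ℝ) * (L / μ) ^ (2 / 7 : ℝ)) * (1 + Real.log m) := by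
      nlinarith
    linarith
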